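/- Let $\tau\in\mathbb C$ with $\operatorname{Im}\tau>0$, and put $p=e^{2\pi i\tau}$, $\sqrt p=e^{\pi i\tau}$, $(a;p)_\infty=\prod_{k\ge 0}(1-ap^k)$, $\theta(x;p)=(x;p)_\infty(p/x;p)_\infty$ and $\theta(ax^\pm;p)=\theta(ax;p)\,\theta(a/x;p)$. Let $\mathcal E_\tau$ be the field of elliptic functions with periods $1$ and $\tau$, that is, of meromorphic functions $f$ on $\mathbb C$ with $f(z+1)=f(z+\tau)=f(z)$. For $a,b\in\mathbb C^\ast$ put, with $x=e^{2\pi iz}$, $$X_{a,b}=\frac{\theta(ax^\pm;p)}{\theta(bx^\pm;p)},\qquad Y_b=\frac{\theta(x^2;p)}{x\,\theta(bx^\pm;p)^2},$$ considered as functions of $z$. For $l\in\mathbb C$ let $K_l=\mathbb C(X,Y)/(Y^2-X(X-1)(X-l))$, that is, the field of fractions of $\mathbb C[X,Y]/(Y^2-X(X-1)(X-l))$. Then: (i) If $ab,a/b\notin p^{\mathbb Z}$, then $X_{a,b},Y_b\in\mathcal E_\tau$, and these two functions generate the field $\mathcal E_\tau$ over $\mathbb C$. (ii) If $\{a,b,c,d\}=\{1,-1,\sqrt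 p,-\sqrt p\}$, and $A$ and $B$ denote the values of $X_{a,b}$ at $x=c$ and $x=d$, then $A\neq 0$, and for some constant $\kappa\neq 0$ there is an isomorphism of $\mathbb C$-algebras $K_{B/A}\to\mathcal E_\tau$ with $X\mapsto A^{-1}X_{a,b}$ and $Y\mapsto\kappa Y_b$. (iii) In particular, let $$\lambda(\tau)=16\sqrt p\,\frac{(-p;p)_\infty^8}{(-\sqrt p;p)_\infty^8}$$ be the lambda invariant. Then there is an isomorphism of $\mathbb C$-algebras $\mathbb C(X,Y)/(Y^2-X(X-1)(X-\lambda(\tau)))\to\mathcal E_\tau$ that maps $X$ and $Y$ to non-zero constant multiples of $X_{a,b}$ and $Y_b$ with $a=-1$ and $b=-\sqrt p$. -/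

import Mathlib

open scoped Polynomial

noncomputable section

namespace EllipticFunctions

/-! ### Elliptic functions with periods `1` and `τ` -/

/-- The algebra of all functions `f : ℂ → ℂ` that are meromorphic on `ℂ` and satisfy
`f (z + 1) = f (z + τ) = f z` for all `z`. A function in the sense of Lean also has some value at
its poles (and may have wrong values at isolated points), so two elements of this algebra stand for
the same meromorphic function when they agree away from a closed discrete set. -/
def periodicMeromorphic (τ : ℂ) : Subalgebra ℂ (ℂ → ℂ) where
  carrier := {f | Meromorphic f ∧ (∀ z, f (z + 1) = f z) ∧ ∀ z, f (z + τ) = f z}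
  mul_mem' := by
    rintro f g ⟨hf, hf1, hf2⟩ ⟨hg, hg1, hg2⟩
    exact ⟨fun z => (hf z).mul (hg z), fun z => by simp [hf1, hg1], fun z => by simp [hf2, hg2]⟩
  add_mem' := by
    rintro f g ⟨hf, hf1, hf2⟩ ⟨hg, hg1, hg2⟩
    exact ⟨fun z => (hf z).add (hg z), fun z => by simp [hf1, hg1], fun z => by simp [hf2, hg2]⟩
  algebraMap_mem' c := ⟨fun z => MeromorphicAt.const c z, fun _ => rfl, fun _ => rfl⟩

/-- The ideal of those functions that vanish outside a closed discrete set, that is, that are zero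
as meromorphic functions. -/
def zeroIdeal (τ : ℂ) : Ideal (periodicMeromorphic τ) where
  carrier := {f | (f : ℂ → ℂ) =ᶠ[Filter.codiscrete ℂ] 0}
  add_mem' := by
    intro f g hf hg
    change ∀ᶠ z in Filter.codiscrete ℂ, (f : ℂ → ℂ) z + (g : ℂ → ℂ) z = 0
    filter_upwards [hf, hg] with z h1 h2
    simp [h1, h2]
  zero_mem' := by
    change (fun _ => 0 : ℂ → ℂ) =ᶠ[Filter.codiscrete ℂ] 0
    exact Filter.EventuallyEq.rfl
  smul_mem' := by
    intro c f hf
    change ∀ᶠ z in Filter.codiscrete ℂ, (c : ℂ → ℂ) z * (f : ℂ → ℂ) z = 0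
    filter_upwards [hf] with z h1
    simp [h1]

theorem mem_zeroIdeal {τ : ℂ} {f : periodicMeromorphic τ} :
    f ∈ zeroIdeal τ ↔ (f : ℂ → ℂ) =ᶠ[Filter.codiscrete ℂ] 0 := Iff.rfl

theorem eventually_nhdsNE {P : ℂ → Prop} (h : ∀ᶠ z in Filter.codiscrete ℂ, P z) (x : ℂ) :
    ∀ᶠ z in nhdsWithin x {x}ᶜ, P z := by
  have h1 := mem_codiscrete.1 h x
  rw [Filter.disjoint_principal_right, compl_compl] at h1
  exact h1

/-- A meromorphic function on `ℂ` that is not zero has zeros only at a closed discrete set. -/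
theorem eventually_ne_zero {f : ℂ → ℂ} (hf : Meromorphic f)
    (h : ¬ f =ᶠ[Filter.codiscrete ℂ] 0) : ∀ᶠ z in Filter.codiscrete ℂ, f z ≠ 0 := by
  have hf' : MeromorphicOn f Set.univ := fun z _ => hf z
  refine hf'.eventually_codiscreteWithin_apply_ne_zero fun y hy => ?_
  by_contra hy'
  apply h
  have hall : ∀ x, meromorphicOrderAt f x = ⊤ := by
    intro x
    by_contra hx
    exact hf'.meromorphicOrderAt_ne_top_of_isPreconnected isPreconnected_univ
      (Set.mem_univ x) hy hx hy'
  change {z | f z = 0} ∈ Filter.codiscrete ℂ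
  rw [mem_codiscrete]
  intro x
  rw [Filter.disjoint_principal_right, compl_compl]
  exact meromorphicOrderAt_eq_top_iff.1 (hall x)

instance (τ : ℂ) : (zeroIdeal τ).IsMaximal := by
  rw [Ideal.isMaximal_iff]
  refine ⟨?_, ?_⟩
  · intro h
    rw [mem_zeroIdeal] at h
    obtain ⟨z, hz⟩ := (eventually_nhdsNE h 0).exists
    simp at hz
  · intro J f hIJ hf hfJ
    have hne := eventually_ne_zero f.2.1 hf
    let g : periodicMeromorphic τ := ⟨(f : ℂ → ℂ)⁻¹, fun z => (f.2.1 z).inv,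
      fun z => by simp [f.2.2.1 z], fun z => by simp [f.2.2.2 z]⟩
    have h1 : 1 - g * f ∈ zeroIdeal τ := by
      rw [mem_zeroIdeal]
      filter_upwards [hne] with z hz
      simp [g, hz]
    have h2 : (1 : periodicMeromorphic τ) = (1 - g * f) + g * f := by ring
    rw [h2]
    exact J.add_mem (hIJ h1) (J.mul_mem_left g hfJ)

/-- The field of elliptic functions with periods `1` and `τ`: meromorphic functions on `ℂ` with
these periods. -/
abbrev EllipticField (τ : ℂ) : Type := periodicMeromorphic τ ⧸ zeroIdeal τ

instance (τ : ℂ) : Field (EllipticField τ) := Ideal.Quotient.field (zeroIdeal τ)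

/-- `Represents F f`: the function `f` is meromorphic with periods `1` and `τ`, and `F` is the
elliptic function given by `f`. -/
def Represents {τ : ℂ} (F : EllipticField τ) (f : ℂ → ℂ) : Prop :=
  ∃ hf : f ∈ periodicMeromorphic τ, F = Ideal.Quotient.mk (zeroIdeal τ) ⟨f, hf⟩

/-! ### Theta functions -/

/-- The infinite product `(a; p)_∞`. -/
def qPoch (a p : ℂ) : ℂ := ∏' k : ℕ, (1 - a * p ^ k)

/-- The theta function `θ(x; p) = (x; p)_∞ (p / x; p)_∞`. -/
def theta (x p : ℂ) : ℂ := qPoch x p * qPoch (p / x) p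

/-- The product `θ(a x^±; p) = θ(a x; p) θ(a / x; p)`. -/
def thetaPM (a x p : ℂ) : ℂ := theta (a * x) p * theta (a / x) p

/-- `X(x) = θ(a x^±; p) / θ(b x^±; p)`. -/
def funX (a b p x : ℂ) : ℂ := thetaPM a x p / thetaPM b x p

/-- `Y(x) = θ(x²; p) / (x θ(b x^±; p)²)`. -/
def funY (b p x : ℂ) : ℂ := theta (x ^ 2) p / (x * thetaPM b x p ^ 2)

/-- The multiplicative coordinate `x = e^{2 π i z}`; for `z = τ` it gives `p = e^{2 π i τ}`, and for
`z = τ / 2` the square root `e^{π i τ}` of `p`. -/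
def ex (z : ℂ) : ℂ := Complex.exp (2 * Real.pi * Complex.I * z)

/-- The lambda invariant `λ(τ) = 16 √p (-p; p)_∞^8 / (-√p; p)_∞^8` with `p = e^{2 π i τ}` and
`√p = e^{π i τ}`. -/
def lambdaInv (τ : ℂ) : ℂ :=
  16 * ex (τ / 2) * qPoch (-ex τ) (ex τ) ^ 8 / qPoch (-ex (τ / 2)) (ex τ) ^ 8

/-! ### The field `ℂ(X, Y) / (Y² - X (X - 1) (X - l))` -/

/-- The polynomial `Y² - X (X - 1) (X - l)` in `ℂ[X][Y]`. -/
def legendrePoly (l : ℂ) : ℂ[X][X] :=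
  Polynomial.X ^ 2 -
    Polynomial.C (Polynomial.X * (Polynomial.X - 1) * (Polynomial.X - Polynomial.C l))

theorem irreducible_legendrePoly (l : ℂ) : Irreducible (legendrePoly l) := by
  have h : legendrePoly l =
      WeierstrassCurve.Affine.polynomial (⟨0, -(1 + l), 0, l, 0⟩ : WeierstrassCurve.Affine ℂ) := by
    rw [WeierstrassCurve.Affine.polynomial, legendrePoly]
    simp
    ring
  rw [h]
  exact WeierstrassCurve.Affine.irreducible_polynomial

instance (l : ℂ) : IsDomain (AdjoinRoot (legendrePoly l)) :=
  AdjoinRoot.isDomain_of_prime (irreducible_legendrePoly l).prime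

/-- The field of fractions of `ℂ[X, Y] / (Y² - X (X - 1) (X - l))`. -/
abbrev LegendreField (l : ℂ) : Type := FractionRing (AdjoinRoot (legendrePoly l))

/-- The class of `X`. -/
def legendreX (l : ℂ) : LegendreField l :=
  algebraMap (AdjoinRoot (legendrePoly l)) (LegendreField l)
    (AdjoinRoot.of (legendrePoly l) Polynomial.X)

/-- The class of `Y`. -/
def legendreY (l : ℂ) : LegendreField l :=
  algebraMap (AdjoinRoot (legendrePoly l)) (LegendreField l) (AdjoinRoot.root (legendrePoly l))

end EllipticFunctions

end

noncomputable section

namespace EllipticFunctions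

open Complex Filter Topology

/-! ### Infinite products and theta functions -/

/-! The reflection `z ↦ -z` splits every elliptic function into an even and an odd part. `Y_b` is
odd and non-zero, so dividing the odd part by it reduces generation to showing that every even
function lies in `ℂ(X_{a,b})`. With `b = ex β`, the poles of `X_{a,b}` lie only at `±β` modulo
periods and have the least order `e` available to even functions there: `2` if `β` is a half period,
`1` otherwise (`IsEvenCoordinate`). Given an even `F`, a polynomial in `X` clears its poles away
from `±β`. Subtracting multiples of powers of `X` then lowers the pole order in steps of `e`, until
Liouville's theorem leaves a constant (`IsEvenCoordinate.mem_of_even`).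

When `a, b, c, d` are the four half-period values, `X_{a,b}` and `X_{c,b}` have the same double
pole, so the same reduction makes them affine functions of each other: `X_{a,b} - A` is a non-zero
multiple of `X_{c,b}`, and likewise `X_{a,b} - B` of `X_{d,b}` (`exists_ellX_sub_eq`). The
duplication formula for theta gives `Y_b² = -X_{a,b} X_{c,b} X_{d,b}` (`ellY_sq`), hence a Legendre
equation after rescaling. Transcendence of `X` makes the map from the Legendre field well defined,
and generation makes it surjective (`exists_legendreField_equiv`). The lambda invariant is `B / A`
for one choice, evaluated explicitly. -/

theorem ex_add (z w : ℂ) : ex (z + w) = ex z * ex w := by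
  simp [ex, mul_add, Complex.exp_add]

theorem ex_neg (z : ℂ) : ex (-z) = (ex z)⁻¹ := by
  simp [ex, Complex.exp_neg]

theorem ex_sub (z w : ℂ) : ex (z - w) = ex z / ex w := by
  rw [sub_eq_add_neg, ex_add, ex_neg, div_eq_mul_inv]

theorem ex_ne_zero (z : ℂ) : ex z ≠ 0 := Complex.exp_ne_zero _

theorem ex_zero : ex 0 = 1 := by simp [ex]

theorem ex_eq_one_iff {z : ℂ} : ex z = 1 ↔ ∃ n : ℤ, z = n := by
  rw [ex, Complex.exp_eq_one_iff]
  refine exists_congr fun n => ?_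
  rw [mul_comm (n : ℂ)]
  exact mul_right_inj' Complex.two_pi_I_ne_zero

theorem ex_int (n : ℤ) : ex n = 1 := ex_eq_one_iff.2 ⟨n, rfl⟩

theorem ex_one : ex 1 = 1 := by simpa using ex_int 1

theorem ex_int_mul (n : ℤ) (z : ℂ) : ex (n * z) = ex z ^ n := by
  rw [ex, ex, ← Complex.exp_int_mul]
  congr 1
  ring

theorem exists_ex_eq {a : ℂ} (ha : a ≠ 0) : ∃ z, ex z = a := by
  refine ⟨Complex.log a / (2 * Real.pi * Complex.I), ?_⟩
  rw [ex, mul_div_cancel₀ _ Complex.two_pi_I_ne_zero, Complex.exp_log ha]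

theorem differentiable_ex : Differentiable ℂ ex := by
  unfold ex
  fun_prop

theorem norm_ex_lt_one {τ : ℂ} (hτ : 0 < τ.im) : ‖ex τ‖ < 1 := by
  rw [ex, Complex.norm_exp]
  have : (2 * Real.pi * Complex.I * τ).re = -(2 * Real.pi * τ.im) := by simp
  rw [this, Real.exp_lt_one_iff]
  have := Real.pi_pos
  have := mul_pos this hτ
  linarith

variable {p : ℂ}

theorem summable_mul_pow (hp : ‖p‖ < 1) (a : ℂ) : Summable fun k : ℕ => ‖-(a * p ^ k)‖ := by
  simpa using (summable_geometric_of_lt_one (norm_nonneg _) hp).mul_left ‖a‖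

theorem multipliable_qPoch (hp : ‖p‖ < 1) (a : ℂ) :
    Multipliable fun k : ℕ => 1 - a * p ^ k := by
  simpa [sub_eq_add_neg] using multipliable_one_add_of_summable (summable_mul_pow hp a)

theorem qPoch_eq_mul (hp : ‖p‖ < 1) (a : ℂ) : qPoch a p = (1 - a) * qPoch (p * a) p := by
  have h := tprod_eq_zero_mul' (f := fun k : ℕ => 1 - a * p ^ k) (by
    have := multipliable_qPoch hp (p * a)
    convert this using 2 with k
    ring)
  rw [qPoch, h, qPoch]
  simp only [pow_zero, mul_one]
  congr 1
  refine tprod_congr fun k => ?_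
  ring

theorem qPoch_ne_zero (hp : ‖p‖ < 1) {a : ℂ} (h : ∀ k : ℕ, a * p ^ k ≠ 1) : qPoch a p ≠ 0 := by
  have := tprod_one_add_ne_zero_of_summable (f := fun k : ℕ => -(a * p ^ k))
    (fun k hk => h k (by linear_combination -hk)) (summable_mul_pow hp a)
  simpa [qPoch, sub_eq_add_neg] using this

theorem differentiable_qPoch (hp : ‖p‖ < 1) : Differentiable ℂ fun a => qPoch a p := by
  intro a
  have h := Summable.hasProdLocallyUniformlyOn_nat_one_add
    (f := fun (k : ℕ) (x : ℂ) => -(x * p ^ k)) (K := Metric.ball (0 : ℂ) (‖a‖ + 1))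
    Metric.isOpen_ball
    ((summable_geometric_of_lt_one (norm_nonneg _) hp).mul_left (‖a‖ + 1))
    (.of_forall fun n x hx => by
      rw [norm_neg, norm_mul, norm_pow]
      gcongr
      simpa using (Metric.mem_ball.1 hx).le)
    (fun n => by fun_prop)
  have h' := h.differentiableOn
    (.of_forall fun _ ↦ by simpa [Finset.prod_fn] using
      DifferentiableOn.finsetProd (fun _ _ ↦ by fun_prop)) Metric.isOpen_ball
  have h2 := h'.differentiableAt (x := a) (Metric.isOpen_ball.mem_nhds (by simp))
  simpa [qPoch, sub_eq_add_neg] using h2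

theorem theta_eq_mul (hp : ‖p‖ < 1) (x : ℂ) :
    theta x p = (1 - x) * (qPoch (p * x) p * qPoch (p / x) p) := by
  rw [theta, qPoch_eq_mul hp x, mul_assoc]

theorem theta_inv (hp : ‖p‖ < 1) {x : ℂ} (hx : x ≠ 0) : theta x⁻¹ p = -theta x p / x := by
  rw [theta_eq_mul hp, theta_eq_mul hp, div_inv_eq_mul, ← div_eq_mul_inv]
  field_simp
  ring

theorem theta_mul (hp : ‖p‖ < 1) (hp0 : p ≠ 0) {x : ℂ} (hx : x ≠ 0) :
    theta (p * x) p = -theta x p / x := by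
  rw [← theta_inv hp hx, theta, theta, div_inv_eq_mul, mul_comm p x, mul_comm,
    mul_comm x p, div_mul_cancel_left₀ hp0]

theorem theta_ne_zero (hp : ‖p‖ < 1) (hp0 : p ≠ 0) {x : ℂ} (hx : x ≠ 0)
    (h : ∀ n : ℤ, x ≠ p ^ n) : theta x p ≠ 0 := by
  refine mul_ne_zero (qPoch_ne_zero hp fun k hk => h (-k) ?_)
    (qPoch_ne_zero hp fun k hk => h (k + 1) ?_)
  · rw [zpow_neg, zpow_natCast]
    exact eq_inv_of_mul_eq_one_left hk
  · rw [zpow_add_one₀ hp0, zpow_natCast]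
    field_simp at hk
    rw [← hk]
    ring

theorem qPoch_mul_qPoch_neg {s : ℂ} (hs : ‖s‖ < 1) (x : ℂ) :
    qPoch x s * qPoch (-x) s = qPoch (x ^ 2) (s ^ 2) := by
  rw [qPoch, qPoch, qPoch, ← (multipliable_qPoch hs x).tprod_mul (multipliable_qPoch hs (-x))]
  refine tprod_congr fun k => ?_
  ring

theorem qPoch_eq_even_mul_odd {s : ℂ} (hs : ‖s‖ < 1) (x : ℂ) :
    qPoch x s = qPoch x (s ^ 2) * qPoch (s * x) (s ^ 2) := by
  have hs2 : ‖s ^ 2‖ < 1 := by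
    rw [norm_pow]
    exact pow_lt_one₀ (norm_nonneg _) hs two_ne_zero
  have h := tprod_even_mul_odd (f := fun k : ℕ => 1 - x * s ^ k)
    (by simpa [pow_mul] using multipliable_qPoch hs2 x)
    (by
      convert multipliable_qPoch hs2 (s * x) using 2 with k
      ring)
  rw [qPoch, ← h, qPoch, qPoch]
  congr 1
  · exact tprod_congr fun k => by ring
  · exact tprod_congr fun k => by ring

/-- Pairing the factors of `x` and `-x` gives `(x²; s²) = (x; s)(-x; s)`, and splitting by the
parity of the exponent turns each product in base `s` into two in base `s²`. With `s = √p` the four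
theta factors vanish at the four half periods. -/
theorem theta_sq {s : ℂ} (hs : ‖s‖ < 1) (hs0 : s ≠ 0) {x : ℂ} (hx : x ≠ 0) :
    theta (x ^ 2) (s ^ 2) = theta x (s ^ 2) * theta (-x) (s ^ 2) * theta (s * x) (s ^ 2) *
      theta (-(s * x)) (s ^ 2) := by
  have e1 : s ^ 2 / x ^ 2 = (s / x) ^ 2 := by ring
  have e2 : s ^ 2 / x = s * (s / x) := by ring
  have e3 : s ^ 2 / -x = s * -(s / x) := by field_simp
  have e4 : s ^ 2 / (s * x) = s / x := by field_simp
  have e5 : s ^ 2 / -(s * x) = -(s / x) := by field_simp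
  rw [theta, theta, theta, theta, theta, e1, e2, e3, e4, e5, ← qPoch_mul_qPoch_neg hs,
    ← qPoch_mul_qPoch_neg hs, qPoch_eq_even_mul_odd hs x, qPoch_eq_even_mul_odd hs (-x),
    qPoch_eq_even_mul_odd hs (s / x), qPoch_eq_even_mul_odd hs (-(s / x)), mul_neg s x]
  ring

/-! ### Analyticity and zeros of theta in the additive coordinate -/

variable {τ : ℂ}

theorem analyticAt_theta_ex (hτ : 0 < τ.im) (z : ℂ) :
    AnalyticAt ℂ (fun w => theta (ex w) (ex τ)) z := by
  refine Differentiable.analyticAt ?_ z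
  have h := differentiable_qPoch (norm_ex_lt_one hτ)
  refine (h.comp differentiable_ex).mul (h.comp ?_)
  exact fun w => (differentiableAt_const _).div (differentiable_ex w) (ex_ne_zero w)

theorem qPoch_ex_ne_zero (hτ : 0 < τ.im) : qPoch (ex τ) (ex τ) ≠ 0 := by
  refine qPoch_ne_zero (norm_ex_lt_one hτ) fun k hk => ?_
  have := congr_arg norm hk
  rw [← pow_succ', norm_pow, norm_one] at this
  exact (pow_lt_one₀ (norm_nonneg _) (norm_ex_lt_one hτ) (Nat.succ_ne_zero k)).ne this

/-- The zero comes from the factor `1 - x` alone: the cofactor at `x = 1` is `(p; p)_∞²`, which is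
non-zero. -/
theorem order_theta_ex_zero (hτ : 0 < τ.im) :
    meromorphicOrderAt (fun w => theta (ex w) (ex τ)) 0 = 1 := by
  have h := differentiable_qPoch (norm_ex_lt_one hτ)
  have h1 : AnalyticAt ℂ (fun w => qPoch (ex τ * ex w) (ex τ) * qPoch (ex τ / ex w) (ex τ)) 0 := by
    refine Differentiable.analyticAt ?_ _
    refine (h.comp (differentiable_ex.const_mul _)).mul (h.comp ?_)
    exact fun w => (differentiableAt_const _).div (differentiable_ex w) (ex_ne_zero w)
  have h2 : AnalyticAt ℂ (fun w => 1 - ex w) 0 :=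
    (differentiable_ex.const_sub 1).analyticAt 0
  have h3 : meromorphicOrderAt (fun w => 1 - ex w) 0 = 1 := by
    have hd : HasDerivAt (fun w => 1 - ex w) (-(2 * Real.pi * Complex.I)) 0 := by
      have h := ((hasDerivAt_id (0 : ℂ)).const_mul (2 * Real.pi * Complex.I)).cexp.const_sub 1
      simpa [ex] using h
    -- Composing `id` with a map of non-zero derivative shows that the zero is simple.
    have := meromorphicOrderAt_comp_of_deriv_ne_zero (f := (id : ℂ → ℂ))
      (g := fun w => 1 - ex w) (x := 0) h2
      (by rw [hd.deriv]; exact neg_ne_zero.2 Complex.two_pi_I_ne_zero)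
    simpa [Function.comp_def, ex_zero, meromorphicOrderAt_id] using this
  have h4 : (fun w => theta (ex w) (ex τ)) = (fun w => qPoch (ex τ * ex w) (ex τ) *
      qPoch (ex τ / ex w) (ex τ)) * (fun w => 1 - ex w) := by
    ext w
    rw [theta_eq_mul (norm_ex_lt_one hτ), Pi.mul_apply, mul_comm]
  have h5 : qPoch (ex τ * ex 0) (ex τ) * qPoch (ex τ / ex 0) (ex τ) ≠ 0 := by
    simpa [ex_zero] using qPoch_ex_ne_zero hτ
  rw [h4, meromorphicOrderAt_mul_of_ne_zero h1 h5, h3]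

theorem order_theta_ex_of_ne (hτ : 0 < τ.im) {z : ℂ} (hz : ∀ n : ℤ, ex z ≠ ex τ ^ n) :
    meromorphicOrderAt (fun w => theta (ex w) (ex τ)) z = 0 := by
  have h := analyticAt_theta_ex hτ z
  rw [h.meromorphicOrderAt_eq, h.analyticOrderAt_eq_zero.2]
  · simp
  · exact theta_ne_zero (norm_ex_lt_one hτ) (ex_ne_zero _) (ex_ne_zero _) hz

theorem order_theta_ex_add_period (hτ : 0 < τ.im) (z : ℂ) :
    meromorphicOrderAt (fun w => theta (ex w) (ex τ)) (z + τ) =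
      meromorphicOrderAt (fun w => theta (ex w) (ex τ)) z := by
  rw [← meromorphicOrderAt_comp_add_const_eq_meromorphicOrderAt]
  have h4 : (fun w => theta (ex w) (ex τ)) ∘ (· + τ) =
      (fun w => -(ex w)⁻¹) * (fun w => theta (ex w) (ex τ)) := by
    ext w
    simp only [Function.comp_apply, Pi.mul_apply]
    rw [ex_add, mul_comm (ex w), theta_mul (norm_ex_lt_one hτ) (ex_ne_zero _) (ex_ne_zero _)]
    ring
  have h5 : AnalyticAt ℂ (fun w => -(ex w)⁻¹) z :=
    ((differentiable_ex.analyticAt z).inv (ex_ne_zero z)).neg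
  have h6 := meromorphicOrderAt_mul_of_ne_zero (f := fun w => theta (ex w) (ex τ)) h5
    (neg_ne_zero.2 (inv_ne_zero (ex_ne_zero z)))
  rw [← h6, ← h4]

theorem order_theta_ex (hτ : 0 < τ.im) {z : ℂ} {n : ℤ} (hz : ex z = ex τ ^ n) :
    meromorphicOrderAt (fun w => theta (ex w) (ex τ)) z = 1 := by
  have key : ∀ n : ℤ, meromorphicOrderAt (fun w => theta (ex w) (ex τ)) (n * τ) = 1 := by
    intro n
    induction n using Int.induction_on with
    | zero => simpa using order_theta_ex_zero hτ
    | succ k ih =>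
      have h := order_theta_ex_add_period hτ (((k : ℤ) : ℂ) * τ)
      rw [ih] at h
      rw [← h]
      push_cast
      ring_nf
    | pred k ih =>
      have h := order_theta_ex_add_period hτ (((-(k : ℤ) - 1 : ℤ) : ℂ) * τ)
      rw [← h, ← ih]
      push_cast
      ring_nf
  have h1 : ex (z - n * τ) = 1 := by
    rw [ex_sub, ex_int_mul, hz, div_self (zpow_ne_zero _ (ex_ne_zero _))]
  obtain ⟨m, hm⟩ := ex_eq_one_iff.1 h1
  have h2 : z = n * τ + m := by rw [← hm]; ring
  have h3 : (fun w => theta (ex w) (ex τ)) ∘ (· + (m : ℂ)) = fun w => theta (ex w) (ex τ) := by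
    ext w
    simp [ex_add, ex_int]
  rw [← key n, h2, ← meromorphicOrderAt_comp_add_const_eq_meromorphicOrderAt, h3]

theorem order_theta_mul_ex (β z : ℂ) :
    meromorphicOrderAt (fun w => theta (ex β * ex w) (ex τ)) z =
      meromorphicOrderAt (fun w => theta (ex w) (ex τ)) (z + β) := by
  rw [← meromorphicOrderAt_comp_add_const_eq_meromorphicOrderAt]
  congr 1
  ext w
  simp [ex_add, mul_comm]

theorem order_theta_div_ex (β z : ℂ) :
    meromorphicOrderAt (fun w => theta (ex β / ex w) (ex τ)) z =
      meromorphicOrderAt (fun w => theta (ex w) (ex τ)) (β - z) := by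
  have hd : HasDerivAt (fun w => β - w) (-1) z := by
    simpa using (hasDerivAt_id z).const_sub β
  have := meromorphicOrderAt_comp_of_deriv_ne_zero (f := fun w => theta (ex w) (ex τ))
    (g := fun w => β - w) (x := z) (by fun_prop) (by rw [hd.deriv]; simp)
  rw [← this]
  congr 1
  ext w
  simp [ex_sub]

/-! ### The products `θ(a x^±)` and the functions `X` and `Y` -/

theorem thetaPM_inv (a x : ℂ) : thetaPM a x⁻¹ p = thetaPM a x p := by
  rw [thetaPM, thetaPM, div_inv_eq_mul, ← div_eq_mul_inv, mul_comm]

theorem thetaPM_mul (hp : ‖p‖ < 1) (hp0 : p ≠ 0) {a x : ℂ} (ha : a ≠ 0) (hx : x ≠ 0) :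
    thetaPM a (p * x) p = (p * x ^ 2)⁻¹ * thetaPM a x p := by
  have h1 : theta (a * (p * x)) p = -theta (a * x) p / (a * x) := by
    rw [← theta_mul hp hp0 (mul_ne_zero ha hx)]
    ring_nf
  have h2 : theta (a / x) p = -theta (a / (p * x)) p / (a / (p * x)) := by
    rw [← theta_mul hp hp0 (by positivity)]
    congr 1
    field_simp
  rw [thetaPM, thetaPM, h1, h2]
  field_simp

theorem thetaPM_ne_zero (hp : ‖p‖ < 1) (hp0 : p ≠ 0) {a x : ℂ} (ha : a ≠ 0) (hx : x ≠ 0)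
    (h1 : ∀ n : ℤ, a * x ≠ p ^ n) (h2 : ∀ n : ℤ, a / x ≠ p ^ n) : thetaPM a x p ≠ 0 :=
  mul_ne_zero (theta_ne_zero hp hp0 (mul_ne_zero ha hx) h1)
    (theta_ne_zero hp hp0 (div_ne_zero ha hx) h2)

theorem theta_one (hp : ‖p‖ < 1) : theta 1 p = 0 := by
  simp [theta_eq_mul hp]

theorem thetaPM_self (hp : ‖p‖ < 1) {a : ℂ} (ha : a ≠ 0) : thetaPM a a p = 0 := by
  rw [thetaPM, div_self ha, theta_one hp, mul_zero]

theorem funX_inv (a b x : ℂ) : funX a b p x⁻¹ = funX a b p x := by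
  rw [funX, funX, thetaPM_inv, thetaPM_inv]

theorem funX_mul (hp : ‖p‖ < 1) (hp0 : p ≠ 0) {a b x : ℂ} (ha : a ≠ 0) (hb : b ≠ 0)
    (hx : x ≠ 0) : funX a b p (p * x) = funX a b p x := by
  rw [funX, funX, thetaPM_mul hp hp0 ha hx, thetaPM_mul hp hp0 hb hx,
    mul_div_mul_left _ _ (by positivity)]

theorem funY_inv (hp : ‖p‖ < 1) (b : ℂ) {x : ℂ} (hx : x ≠ 0) :
    funY b p x⁻¹ = -funY b p x := by
  rw [funY, funY, thetaPM_inv, inv_pow, theta_inv hp (pow_ne_zero 2 hx)]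
  field_simp

theorem funY_mul (hp : ‖p‖ < 1) (hp0 : p ≠ 0) {b x : ℂ} (hb : b ≠ 0)
    (hx : x ≠ 0) : funY b p (p * x) = funY b p x := by
  have h1 : theta ((p * x) ^ 2) p = theta (x ^ 2) p / (p * x ^ 4) := by
    rw [show (p * x) ^ 2 = p * (p * x ^ 2) by ring,
      theta_mul hp hp0 (by positivity), theta_mul hp hp0 (by positivity)]
    field_simp
  rw [funY, funY, thetaPM_mul hp hp0 hb hx, h1]
  field_simp

theorem analyticAt_theta_mul_ex (hτ : 0 < τ.im) (a z : ℂ) :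
    AnalyticAt ℂ (fun w => theta (a * ex w) (ex τ)) z := by
  refine Differentiable.analyticAt ?_ z
  have h := differentiable_qPoch (norm_ex_lt_one hτ)
  -- For `a = 0` the argument `a * ex w` is constantly `0`; otherwise the division in `p / (a * ex
  -- w)` is harmless.
  rcases eq_or_ne a 0 with rfl | ha
  · simp
  refine (h.comp (differentiable_ex.const_mul a)).mul (h.comp ?_)
  exact fun w => (differentiableAt_const _).div ((differentiable_ex.const_mul a) w)
    (mul_ne_zero ha (ex_ne_zero w))

theorem analyticAt_theta_div_ex (hτ : 0 < τ.im) (a z : ℂ) :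
    AnalyticAt ℂ (fun w => theta (a / ex w) (ex τ)) z := by
  have h := (analyticAt_theta_mul_ex hτ a (-z)).comp (analyticAt_id.neg : AnalyticAt ℂ (-id) z)
  convert h using 1
  ext w
  simp [ex_neg, div_eq_mul_inv]

theorem analyticAt_thetaPM_ex (hτ : 0 < τ.im) (a z : ℂ) :
    AnalyticAt ℂ (fun w => thetaPM a (ex w) (ex τ)) z :=
  (analyticAt_theta_mul_ex hτ a z).mul (analyticAt_theta_div_ex hτ a z)

theorem analyticAt_theta_ex_sq (hτ : 0 < τ.im) (z : ℂ) :
    AnalyticAt ℂ (fun w => theta (ex w ^ 2) (ex τ)) z := by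
  have h := AnalyticAt.fun_comp (g := fun w => theta (ex w) (ex τ)) (f := fun w => 2 * w) (x := z)
    (analyticAt_theta_ex hτ (2 * z)) (by fun_prop)
  convert h using 1
  ext w
  rw [two_mul, ex_add, sq]

theorem meromorphic_funX_ex (hτ : 0 < τ.im) (a b : ℂ) :
    Meromorphic fun z => funX a b (ex τ) (ex z) := fun z =>
  (analyticAt_thetaPM_ex hτ a z).meromorphicAt.div (analyticAt_thetaPM_ex hτ b z).meromorphicAt

theorem meromorphic_funY_ex (hτ : 0 < τ.im) (b : ℂ) :
    Meromorphic fun z => funY b (ex τ) (ex z) := fun z =>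
  (analyticAt_theta_ex_sq hτ z).meromorphicAt.div
    (((differentiable_ex.analyticAt z).mul ((analyticAt_thetaPM_ex hτ b z).pow 2)).meromorphicAt)

theorem funX_ex_mem (hτ : 0 < τ.im) {a b : ℂ} (ha : a ≠ 0) (hb : b ≠ 0) :
    (fun z => funX a b (ex τ) (ex z)) ∈ periodicMeromorphic τ := by
  refine ⟨meromorphic_funX_ex hτ a b, fun z => ?_, fun z => ?_⟩
  · simp only [ex_add, ex_one, mul_one]
  · simp only [ex_add, mul_comm (ex z)]
    exact funX_mul (norm_ex_lt_one hτ) (ex_ne_zero _) ha hb (ex_ne_zero _)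

theorem funY_ex_mem (hτ : 0 < τ.im) {b : ℂ} (hb : b ≠ 0) :
    (fun z => funY b (ex τ) (ex z)) ∈ periodicMeromorphic τ := by
  refine ⟨meromorphic_funY_ex hτ b, fun z => ?_, fun z => ?_⟩
  · simp only [ex_add, ex_one, mul_one]
  · simp only [ex_add, mul_comm (ex z)]
    exact funY_mul (norm_ex_lt_one hτ) (ex_ne_zero _) hb (ex_ne_zero _)

theorem order_thetaPM_ex_of_ne (hτ : 0 < τ.im) {a z : ℂ} (ha : a ≠ 0)
    (h1 : ∀ n : ℤ, a * ex z ≠ ex τ ^ n) (h2 : ∀ n : ℤ, a / ex z ≠ ex τ ^ n) :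
    meromorphicOrderAt (fun w => thetaPM a (ex w) (ex τ)) z = 0 := by
  have h := analyticAt_thetaPM_ex hτ a z
  rw [h.meromorphicOrderAt_eq, h.analyticOrderAt_eq_zero.2]
  · simp
  · exact thetaPM_ne_zero (norm_ex_lt_one hτ) (ex_ne_zero _) ha (ex_ne_zero _) h1 h2

/-- The factor `θ(b / x)` has a simple zero at `β`, while `θ(b x)` contributes its order at `2β`. So
the zero is double exactly when `b²` is a power of `p`. -/
theorem order_thetaPM_ex (hτ : 0 < τ.im) (β : ℂ) :
    meromorphicOrderAt (fun w => thetaPM (ex β) (ex w) (ex τ)) β =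
      meromorphicOrderAt (fun w => theta (ex w) (ex τ)) (β + β) + 1 := by
  have h := meromorphicOrderAt_mul (analyticAt_theta_mul_ex hτ (ex β) β).meromorphicAt
    (analyticAt_theta_div_ex hτ (ex β) β).meromorphicAt
  rw [order_theta_mul_ex, order_theta_div_ex, sub_self, order_theta_ex_zero hτ] at h
  exact h

theorem order_thetaPM_ex_simple (hτ : 0 < τ.im) {β : ℂ} (hβ : ∀ n : ℤ, ex β ^ 2 ≠ ex τ ^ n) :
    meromorphicOrderAt (fun w => thetaPM (ex β) (ex w) (ex τ)) β = 1 := by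
  rw [order_thetaPM_ex hτ, order_theta_ex_of_ne hτ (fun n => by
    rw [ex_add, ← sq]; exact hβ n), zero_add]

theorem order_thetaPM_ex_double (hτ : 0 < τ.im) {β : ℂ} {n : ℤ} (hβ : ex β ^ 2 = ex τ ^ n) :
    meromorphicOrderAt (fun w => thetaPM (ex β) (ex w) (ex τ)) β = 2 := by
  rw [order_thetaPM_ex hτ, order_theta_ex hτ (n := n) (by rw [ex_add, ← sq, hβ])]
  rfl

end EllipticFunctions

namespace EllipticFunctions

open Complex Filter Topology

/-! ### The field of elliptic functions as a type of its own -/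

/-- The field of elliptic functions; a type synonym that keeps instance search away from the
quotient ring. -/
def EllField (τ : ℂ) : Type := EllipticField τ

instance (τ : ℂ) : Field (EllField τ) := inferInstanceAs (Field (EllipticField τ))

instance (τ : ℂ) : Algebra ℂ (EllField τ) := inferInstanceAs (Algebra ℂ (EllipticField τ))

/-- The elliptic function given by a meromorphic function with periods `1` and `τ`. -/
def toEll (τ : ℂ) : periodicMeromorphic τ →ₐ[ℂ] EllField τ :=
  Ideal.Quotient.mkₐ ℂ (zeroIdeal τ)

/-! ### The order of an elliptic function at a point -/

variable {τ : ℂ}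

theorem eventually_codiscrete_iff {P : ℂ → Prop} :
    (∀ᶠ z in codiscrete ℂ, P z) ↔ ∀ x, ∀ᶠ z in 𝓝[≠] x, P z := by
  refine ⟨eventually_nhdsNE, fun h => ?_⟩
  change {z | P z} ∈ codiscrete ℂ
  rw [mem_codiscrete]
  intro x
  rw [disjoint_principal_right, compl_compl]
  exact h x

theorem toEll_surjective : Function.Surjective (toEll τ) := Ideal.Quotient.mk_surjective

/-- The order of an elliptic function at the point `z`. -/
def ord (z : ℂ) (F : EllField τ) : WithTop ℤ :=
  meromorphicOrderAt ((toEll_surjective F).choose : ℂ → ℂ) z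

theorem toEll_eq_iff {f g : periodicMeromorphic τ} :
    toEll τ f = toEll τ g ↔ (f : ℂ → ℂ) =ᶠ[codiscrete ℂ] g := by
  refine (Ideal.Quotient.eq (I := zeroIdeal τ)).trans ?_
  rw [mem_zeroIdeal]
  constructor <;> intro h <;> filter_upwards [h] with z hz
  · simpa [sub_eq_zero] using hz
  · simp [hz]

/-- Representatives of one elliptic function agree on punctured neighbourhoods, which is all that
the order sees; so the choice in `ord` is immaterial. -/
theorem ord_toEll (z : ℂ) (f : periodicMeromorphic τ) :
    ord z (toEll τ f) = meromorphicOrderAt (f : ℂ → ℂ) z := by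
  have h := (toEll_surjective (toEll τ f)).choose_spec
  exact meromorphicOrderAt_congr (eventually_nhdsNE (toEll_eq_iff.1 h) z)

theorem ord_mul (z : ℂ) (F G : EllField τ) : ord z (F * G) = ord z F + ord z G := by
  obtain ⟨f, rfl⟩ := toEll_surjective F
  obtain ⟨g, rfl⟩ := toEll_surjective G
  rw [← map_mul, ord_toEll, ord_toEll, ord_toEll]
  exact meromorphicOrderAt_mul (f.2.1 z) (g.2.1 z)

theorem le_ord_add (z : ℂ) (F G : EllField τ) :
    min (ord z F) (ord z G) ≤ ord z (F + G) := by
  obtain ⟨f, rfl⟩ := toEll_surjective F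
  obtain ⟨g, rfl⟩ := toEll_surjective G
  rw [← map_add, ord_toEll, ord_toEll, ord_toEll]
  exact meromorphicOrderAt_add (f.2.1 z) (g.2.1 z)

theorem ord_zero (z : ℂ) : ord z (0 : EllField τ) = ⊤ := by
  rw [← map_zero (toEll τ), ord_toEll, meromorphicOrderAt_eq_top_iff]
  exact .of_forall fun _ => rfl

theorem ord_algebraMap (z : ℂ) {c : ℂ} (hc : c ≠ 0) :
    ord z (algebraMap ℂ (EllField τ) c) = 0 := by
  rw [← (toEll τ).commutes, ord_toEll]
  classical
  have := meromorphicOrderAt_const (𝕜 := ℂ) z c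
  rw [if_neg hc] at this
  exact this

theorem ord_algebraMap_nonneg (z c : ℂ) : 0 ≤ ord z (algebraMap ℂ (EllField τ) c) := by
  rcases eq_or_ne c 0 with rfl | hc
  · rw [map_zero, ord_zero]
    exact le_top
  · rw [ord_algebraMap z hc]

theorem ord_one (z : ℂ) : ord z (1 : EllField τ) = 0 := by
  rw [← map_one (algebraMap ℂ (EllField τ)), ord_algebraMap z one_ne_zero]

theorem ord_eq_top_iff {z : ℂ} {F : EllField τ} : ord z F = ⊤ ↔ F = 0 := by
  refine ⟨fun h => ?_, fun h => h ▸ ord_zero z⟩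
  by_contra hF
  have h1 : ord z (F * F⁻¹) = 0 := by rw [mul_inv_cancel₀ hF, ord_one]
  rw [ord_mul, h, top_add] at h1
  exact WithTop.top_ne_zero h1

theorem ord_pow (z : ℂ) (F : EllField τ) (n : ℕ) : ord z (F ^ n) = n • ord z F := by
  induction n with
  | zero => simp [ord_one]
  | succ n ih => rw [pow_succ, ord_mul, ih, succ_nsmul]

theorem ord_neg (z : ℂ) (F : EllField τ) : ord z (-F) = ord z F := by
  have h : (-F) = algebraMap ℂ (EllField τ) (-1) * F := by simp
  rw [h, ord_mul, ord_algebraMap z (by norm_num), zero_add]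

theorem le_ord_sub (z : ℂ) (F G : EllField τ) :
    min (ord z F) (ord z G) ≤ ord z (F - G) := by
  simpa [sub_eq_add_neg, ord_neg] using le_ord_add z F (-G)

theorem ord_mul_nonneg {z : ℂ} {F G : EllField τ} (hF : 0 ≤ ord z F) (hG : 0 ≤ ord z G) :
    0 ≤ ord z (F * G) := by
  rw [ord_mul]
  exact add_nonneg hF hG

theorem ord_aeval_nonneg {z : ℂ} {X : EllField τ} (hX : 0 ≤ ord z X) (P : ℂ[X]) :
    0 ≤ ord z (Polynomial.aeval X P) := by
  induction P using Polynomial.induction_on' with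
  | add P Q hP hQ =>
    rw [map_add]
    exact (le_min hP hQ).trans (le_ord_add _ _ _)
  | monomial n c =>
    rw [Polynomial.aeval_monomial]
    refine ord_mul_nonneg (ord_algebraMap_nonneg _ _) ?_
    rw [ord_pow]
    exact nsmul_nonneg hX n

/-- An elliptic function without a pole at `z` has a value there. -/
theorem exists_ord_sub_pos {z : ℂ} {F : EllField τ} (hF : 0 ≤ ord z F) :
    ∃ c : ℂ, 0 < ord z (F - algebraMap ℂ _ c) := by
  obtain ⟨f, rfl⟩ := toEll_surjective F
  rw [ord_toEll] at hF
  obtain ⟨c, hc⟩ := tendsto_nhds_of_meromorphicOrderAt_nonneg (f.2.1 z) hF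
  refine ⟨c, ?_⟩
  rw [← (toEll τ).commutes, ← map_sub, ord_toEll, ← tendsto_zero_iff_meromorphicOrderAt_pos ((f - algebraMap ℂ _ c).2.1 z)]
  have h := hc.sub_const c
  rwa [sub_self] at h

theorem ord_sub_apply_pos {z : ℂ} {f : periodicMeromorphic τ} (hf : ContinuousAt (f : ℂ → ℂ) z) :
    0 < ord z (toEll τ f -
      algebraMap ℂ (EllField τ) ((f : ℂ → ℂ) z)) := by
  rw [← (toEll τ).commutes, ← map_sub, ord_toEll, ← tendsto_zero_iff_meromorphicOrderAt_pos ((f - algebraMap ℂ _ _).2.1 z)]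
  have h := (hf.tendsto.mono_left (nhdsWithin_le_nhds (s := {z}ᶜ))).sub_const ((f : ℂ → ℂ) z)
  rwa [sub_self] at h

/-! ### Periods -/

theorem apply_add_period {f : ℂ → ℂ} (hf : f ∈ periodicMeromorphic τ) (z : ℂ) (m n : ℤ) :
    f (z + m + n * τ) = f z := by
  have h1 : Function.Periodic f 1 := hf.2.1
  have h2 : Function.Periodic f τ := hf.2.2
  have := h1.int_mul m z
  rw [mul_one] at this
  rw [h2.int_mul n, this]

theorem exists_period_of_ex {z w : ℂ} {n : ℤ} (h : ex z = ex w * ex τ ^ n) :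
    ∃ m : ℤ, z = w + m + n * τ := by
  have h1 : ex (z - w - n * τ) = 1 := by
    rw [ex_sub, ex_sub, ex_int_mul, h]
    field_simp [ex_ne_zero]
  obtain ⟨m, hm⟩ := ex_eq_one_iff.1 h1
  exact ⟨m, by rw [← hm]; ring⟩

theorem ord_add_period (F : EllField τ) (z : ℂ) (m n : ℤ) :
    ord (z + m + n * τ) F = ord z F := by
  obtain ⟨f, rfl⟩ := toEll_surjective F
  rw [ord_toEll, ord_toEll, add_assoc, ← meromorphicOrderAt_comp_add_const_eq_meromorphicOrderAt]
  congr 1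
  ext w
  simp only [Function.comp_apply]
  rw [← add_assoc, apply_add_period f.2]

theorem ord_eq_of_ex (F : EllField τ) {z w : ℂ} {n : ℤ} (h : ex z = ex w * ex τ ^ n) :
    ord z F = ord w F := by
  obtain ⟨m, rfl⟩ := exists_period_of_ex h
  exact ord_add_period F w m n

/-- A compact disc meeting every class modulo periods stands in for the fundamental parallelogram.
-/
theorem exists_mem_closedBall (hτ : 0 < τ.im) (z : ℂ) :
    ∃ w ∈ Metric.closedBall (0 : ℂ) (1 + ‖τ‖), ∃ m n : ℤ, z = w + m + n * τ := by
  set n := ⌊z.im / τ.im⌋ with hn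
  set m := ⌊(z - n * τ).re⌋ with hm
  refine ⟨z - n * τ - m, ?_, m, n, by ring⟩
  rw [mem_closedBall_zero_iff]
  have h1 : |(z - n * τ - m).re| ≤ 1 := by
    have h1 := Int.floor_le (z - n * τ).re
    have h2 := (Int.lt_floor_add_one (z - n * τ).re).le
    rw [← hm] at h1 h2
    have : (z - n * τ - m).re = (z - n * τ).re - m := by simp
    rw [this, abs_le]
    constructor <;> linarith
  have h2 : |(z - n * τ - m).im| ≤ ‖τ‖ := by
    have h1 := Int.floor_le (z.im / τ.im)
    have h2 := (Int.lt_floor_add_one (z.im / τ.im)).le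
    rw [← hn, le_div_iff₀ hτ] at h1
    rw [← hn, div_le_iff₀ hτ] at h2
    have : (z - n * τ - m).im = z.im - n * τ.im := by simp
    have h3 := (le_abs_self _).trans (Complex.abs_im_le_norm τ)
    rw [this, abs_le]
    constructor <;> nlinarith
  exact (Complex.norm_le_abs_re_add_abs_im _).trans (add_le_add h1 h2)

/-- The poles of an elliptic function form finitely many classes modulo periods. -/
theorem exists_finset_poles (hτ : 0 < τ.im) (F : EllField τ) :
    ∃ S : Finset ℂ, ∀ z, ord z F < 0 → ∃ w ∈ S, ∃ n : ℤ, ex z = ex w * ex τ ^ n := by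
  obtain ⟨f, rfl⟩ := toEll_surjective F
  have hf : MeromorphicOn (f : ℂ → ℂ) Set.univ := fun z _ => f.2.1 z
  have hK := isCompact_closedBall (0 : ℂ) (1 + ‖τ‖)
  -- The points where the representative is not analytic form a closed discrete set, hence are
  -- finite in number inside the disc; every pole is congruent to one of them.
  have h := hK.finite_sdiff_of_mem_codiscreteWithin (codiscreteWithin_mono (Set.subset_univ _)
    hf.analyticAt_mem_codiscreteWithin)
  refine ⟨h.toFinset, fun z hz => ?_⟩
  obtain ⟨w, hw, m, n, rfl⟩ := exists_mem_closedBall hτ z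
  refine ⟨w, ?_, n, ?_⟩
  · rw [Set.Finite.mem_toFinset]
    refine ⟨hw, fun hw' => ?_⟩
    rw [ord_add_period, ord_toEll] at hz
    exact hz.not_ge (AnalyticAt.meromorphicOrderAt_nonneg hw')
  · rw [ex_add, ex_add, ex_int, ex_int_mul, mul_one]

/-- An elliptic function without poles is constant. -/
theorem exists_eq_algebraMap (hτ : 0 < τ.im) {F : EllField τ} (hF : ∀ z, 0 ≤ ord z F) :
    ∃ c : ℂ, F = algebraMap ℂ _ c := by
  obtain ⟨f, rfl⟩ := toEll_surjective F
  simp only [ord_toEll] at hF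
  have hf : MeromorphicOn (f : ℂ → ℂ) Set.univ := fun z _ => f.2.1 z
  -- The representative `f` may have wrong values at isolated points. Its normal form `g` is entire
  -- because no order is negative.
  set g := toMeromorphicNFOn (f : ℂ → ℂ) Set.univ with hg
  have hfg : (f : ℂ → ℂ) =ᶠ[codiscrete ℂ] g := toMeromorphicNFOn_eqOn_codiscrete hf
  have hga : ∀ z, AnalyticAt ℂ g z := fun z => by
    rw [← (meromorphicNFOn_toMeromorphicNFOn (f : ℂ → ℂ) Set.univ
      (Set.mem_univ z)).meromorphicOrderAt_nonneg_iff_analyticAt,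
      meromorphicOrderAt_toMeromorphicNFOn hf (Set.mem_univ z)]
    exact hF z
  have hgd : Differentiable ℂ g := fun z => (hga z).differentiableAt
  -- `g` agrees with `f` only off a discrete set, so its periodicity is recovered by continuity.
  have hper : ∀ z (m n : ℤ), g (z + m + n * τ) = g z := by
    intro z m n
    have h1 : Tendsto (fun w => w + m + n * τ) (𝓝[≠] z) (𝓝[≠] (z + m + n * τ)) := by
      refine tendsto_nhdsWithin_iff.2 ⟨?_, ?_⟩
      · exact (Continuous.tendsto (by fun_prop) z).mono_left nhdsWithin_le_nhds
      · filter_upwards [self_mem_nhdsWithin] with w hw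
        simpa using hw
    have h2 : (fun w => g (w + m + n * τ)) =ᶠ[𝓝[≠] z] g := by
      filter_upwards [h1.eventually (eventually_nhdsNE hfg (z + m + n * τ)),
        eventually_nhdsNE hfg z] with w hw1 hw2
      rw [← hw1, ← hw2, apply_add_period f.2]
    have hc := hgd.continuous
    exact tendsto_nhds_unique_of_eventuallyEq
      ((Continuous.tendsto (f := fun w => g (w + m + n * τ)) (by fun_prop) z).mono_left
        nhdsWithin_le_nhds) ((hc.tendsto z).mono_left nhdsWithin_le_nhds) h2
  have hb : Bornology.IsBounded (Set.range g) := by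
    refine (((isCompact_closedBall (0 : ℂ) (1 + ‖τ‖)).image hgd.continuous).isBounded).subset ?_
    rintro _ ⟨z, rfl⟩
    obtain ⟨w, hw, m, n, rfl⟩ := exists_mem_closedBall hτ z
    exact ⟨w, hw, (hper w m n).symm⟩
  obtain ⟨c, hc⟩ := hgd.exists_const_forall_eq_of_bounded hb
  refine ⟨c, ?_⟩
  rw [← (toEll τ).commutes, toEll_eq_iff]
  filter_upwards [hfg] with z hz
  rw [hz, hc]
  rfl

/-! ### Even and odd elliptic functions -/

theorem tendsto_const_sub_nhdsNE (c z : ℂ) :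
    Tendsto (fun w => c - w) (𝓝[≠] z) (𝓝[≠] (c - z)) := by
  refine tendsto_nhdsWithin_iff.2 ⟨?_, ?_⟩
  · exact (Continuous.tendsto (by fun_prop) z).mono_left nhdsWithin_le_nhds
  · filter_upwards [self_mem_nhdsWithin] with w hw
    simpa using hw

/-- The substitution `z ↦ -z` on meromorphic functions with periods `1` and `τ`. -/
def compNeg (τ : ℂ) : periodicMeromorphic τ →ₐ[ℂ] periodicMeromorphic τ where
  toFun f := ⟨fun z => (f : ℂ → ℂ) (-z), by
    refine ⟨fun z => (f.2.1 (-z)).comp_analyticAt (by fun_prop), fun z => ?_, fun z => ?_⟩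
    · have h := f.2.2.1 (-(z + 1))
      rw [neg_add, neg_add_cancel_right, ← neg_add] at h
      exact h.symm
    · have h := f.2.2.2 (-(z + τ))
      rw [neg_add, neg_add_cancel_right, ← neg_add] at h
      exact h.symm⟩
  map_one' := rfl
  map_mul' _ _ := rfl
  map_zero' := rfl
  map_add' _ _ := rfl
  commutes' _ := rfl

/-- The substitution `z ↦ -z` on elliptic functions. -/
def reflect (τ : ℂ) : EllField τ →ₐ[ℂ] EllField τ :=
  Ideal.quotientMapₐ (zeroIdeal τ) (compNeg τ) (by
    intro f hf
    rw [Ideal.mem_comap, mem_zeroIdeal]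
    rw [mem_zeroIdeal] at hf
    refine eventually_codiscrete_iff.2 fun z => ?_
    have h := (tendsto_const_sub_nhdsNE 0 z).eventually (eventually_nhdsNE hf (0 - z))
    simp only [zero_sub] at h
    exact h)

theorem reflect_toEll (f : periodicMeromorphic τ) :
    reflect τ (toEll τ f) =
      toEll τ (compNeg τ f) := rfl

theorem reflect_reflect (F : EllField τ) : reflect τ (reflect τ F) = F := by
  obtain ⟨f, rfl⟩ := toEll_surjective F
  rw [reflect_toEll, reflect_toEll]
  congr 1
  ext z
  change (f : ℂ → ℂ) (- -z) = _
  rw [neg_neg]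

theorem ord_reflect (z : ℂ) (F : EllField τ) : ord z (reflect τ F) = ord (-z) F := by
  obtain ⟨f, rfl⟩ := toEll_surjective F
  rw [reflect_toEll, ord_toEll, ord_toEll]
  have := meromorphicOrderAt_comp_of_deriv_ne_zero (f := (f : ℂ → ℂ))
    (g := fun w => -w) (x := z) (by fun_prop) (by simp)
  exact this

theorem ord_neg_of_even {F : EllField τ} (hF : reflect τ F = F) (z : ℂ) :
    ord (-z) F = ord z F := by
  rw [← ord_reflect, hF]

/-- An even elliptic function that vanishes at half a period vanishes there to order at
least `2`. -/
theorem two_le_ord_of_even {F : EllField τ} (hF : reflect τ F = F) {β : ℂ} {n : ℤ}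
    (hβ : ex β ^ 2 = ex τ ^ n) (h : 0 < ord β F) : 2 ≤ ord β F := by
  obtain ⟨f, rfl⟩ := toEll_surjective F
  rw [reflect_toEll, toEll_eq_iff] at hF
  rw [ord_toEll] at h ⊢
  -- Since `2β` is a period, an even `f` is also symmetric under `w ↦ 2β - w`. Writing `f = (w - β)
  -- g` would give `g(w) = -g(2β - w)` near `β`, so `g(β) = 0`, excluding order `1`.
  have hn1 : meromorphicOrderAt (f : ℂ → ℂ) β ≠ 1 := by
    intro h1
    obtain ⟨g, hg, hg0, hfg⟩ := (meromorphicOrderAt_eq_int_iff (f.2.1 β) (n := 1)).1 h1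
    simp only [zpow_one, smul_eq_mul] at hfg
    obtain ⟨m, hm⟩ := exists_period_of_ex (τ := τ) (z := β) (w := -β) (n := n) (by
      rw [ex_neg, ← hβ]
      field_simp [ex_ne_zero])
    have hsymm : ∀ w, (f : ℂ → ℂ) (2 * β - w) = (f : ℂ → ℂ) (-w) := by
      intro w
      rw [← apply_add_period f.2 (-w) m n]
      refine congr_arg (f : ℂ → ℂ) ?_
      linear_combination hm
    have ht := tendsto_const_sub_nhdsNE (2 * β) β
    rw [show 2 * β - β = β by ring] at ht
    have h2 : ∀ᶠ w in 𝓝[≠] β, g w = -g (2 * β - w) := by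
      filter_upwards [hfg, ht.eventually hfg, eventually_nhdsNE hF β, self_mem_nhdsWithin]
        with w h1 h2 h3 h4
      have h5 : (f : ℂ → ℂ) (-w) = (f : ℂ → ℂ) w := h3
      rw [hsymm, h5, h1] at h2
      have h6 : w - β ≠ 0 := sub_ne_zero.2 h4
      refine mul_left_cancel₀ h6 ?_
      linear_combination h2
    have h3 := hg.continuousAt.tendsto.mono_left (nhdsWithin_le_nhds (s := {β}ᶜ))
    have h4 := (hg.continuousAt.tendsto.mono_left (nhdsWithin_le_nhds (s := {β}ᶜ))).comp ht
    have h5 := tendsto_nhds_unique_of_eventuallyEq h3 h4.neg h2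
    exact hg0 (by linear_combination h5 / 2)
  revert h hn1
  cases meromorphicOrderAt (f : ℂ → ℂ) β with
  | top => simp
  | coe k =>
    intro h1 h2
    have h1' : (0 : ℤ) < k := by exact_mod_cast h1
    have h2' : k ≠ 1 := by exact_mod_cast h2
    exact WithTop.coe_le_coe.2 (show (2 : ℤ) ≤ k by omega)

end EllipticFunctions

namespace EllipticFunctions

open Complex Filter Topology

/-! ### Even elliptic functions are rational functions of a suitable one -/

variable {τ : ℂ}

/-- The points congruent to `β` or `-β` modulo periods. -/
def CongrPM (τ β z : ℂ) : Prop :=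
  ∃ n : ℤ, ex z = ex β * ex τ ^ n ∨ ex z = ex (-β) * ex τ ^ n

theorem CongrPM.of_period {β z w : ℂ} {n : ℤ} (h : ex z = ex w * ex τ ^ n)
    (hw : CongrPM τ β w) : CongrPM τ β z := by
  obtain ⟨m, hm⟩ := hw
  refine ⟨m + n, ?_⟩
  rw [h, zpow_add₀ (ex_ne_zero τ), ← mul_assoc, ← mul_assoc]
  exact hm.imp (fun h => by rw [h]) (fun h => by rw [h])

theorem ord_of_congrPM {F : EllField τ} (hF : reflect τ F = F) {β z : ℂ} (h : CongrPM τ β z) :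
    ord z F = ord β F := by
  obtain ⟨n, h | h⟩ := h
  · exact ord_eq_of_ex F h
  · rw [ord_eq_of_ex F h, ord_neg_of_even hF]

/-- An even elliptic function whose only poles are `±β` modulo periods, of order `e`, where `e` is
the smallest order that an even elliptic function with a zero at `β` can have there. -/
structure IsEvenCoordinate (X : EllField τ) (β : ℂ) (e : ℕ) : Prop where
  even : reflect τ X = X
  pos : 0 < e
  ord_eq : ord β X = ((-e : ℤ) : WithTop ℤ)
  congr_of_neg : ∀ z, ord z X < 0 → CongrPM τ β z
  le_ord : ∀ G : EllField τ, reflect τ G = G → 0 < ord β G → ((e : ℤ) : WithTop ℤ) ≤ ord β G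

theorem le_ord_mul_pow_iff {z : ℂ} {X : EllField τ} {m : ℤ} (hX : ord z X = (m : WithTop ℤ))
    (H : EllField τ) (k : ℤ) (n : ℕ) :
    ((k + n * m : ℤ) : WithTop ℤ) ≤ ord z (H * X ^ n) ↔ (k : WithTop ℤ) ≤ ord z H := by
  have h1 : n • ((m : ℤ) : WithTop ℤ) = ((n * m : ℤ) : WithTop ℤ) := by
    rw [← nsmul_eq_mul]
    exact (WithTop.coe_nsmul m n).symm
  rw [ord_mul, ord_pow, hX, h1]
  cases ord z H with
  | top => simp
  | coe h =>
    rw [← WithTop.coe_add, WithTop.coe_le_coe, WithTop.coe_le_coe]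
    omega

/-- As `ℂ` is algebraically closed, an algebraic element would be a constant, and constants have no
poles. -/
theorem transcendental_of_ord_neg {z : ℂ} {X : EllField τ} (hX : ord z X < 0) :
    Transcendental ℂ X := by
  intro h
  have h1 : (minpoly ℂ X).degree = 1 :=
    IsAlgClosed.degree_eq_one_of_irreducible ℂ (minpoly.irreducible h.isIntegral)
  obtain ⟨c, rfl⟩ := minpoly.mem_range_of_degree_eq_one ℂ X h1
  exact hX.not_ge (ord_algebraMap_nonneg z c)

theorem reflect_aeval {X : EllField τ} (hX : reflect τ X = X) (P : ℂ[X]) :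
    reflect τ (Polynomial.aeval X P) = Polynomial.aeval X P := by
  rw [← Polynomial.aeval_algHom_apply, hX]

theorem IsEvenCoordinate.ord_neg {X : EllField τ} {β : ℂ} {e : ℕ}
    (hX : IsEvenCoordinate X β e) : ord β X < 0 := by
  rw [hX.ord_eq]
  have := hX.pos
  exact WithTop.coe_lt_coe.2 (show (-e : ℤ) < 0 by omega)

theorem IsEvenCoordinate.ne_zero {X : EllField τ} {β : ℂ} {e : ℕ}
    (hX : IsEvenCoordinate X β e) : X ≠ 0 := by
  rintro rfl
  have := hX.ord_neg
  rw [ord_zero] at this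
  exact not_top_lt this

/-- An even elliptic function with poles only at the poles of `X` is a polynomial in `X`. -/
theorem IsEvenCoordinate.exists_eq_aeval (hτ : 0 < τ.im) {X : EllField τ} {β : ℂ} {e : ℕ}
    (hX : IsEvenCoordinate X β e) (n : ℕ) (F : EllField τ) (hF : reflect τ F = F)
    (hpole : ∀ z, ord z F < 0 → CongrPM τ β z)
    (hord : ((n * (-e) : ℤ) : WithTop ℤ) ≤ ord β F) :
    ∃ P : ℂ[X], P.natDegree ≤ n ∧ F = Polynomial.aeval X P := by
  induction n generalizing F with
  | zero =>
    -- All remaining candidate poles are congruent to `±β`, where the order is non-negative, so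
    -- Liouville applies.
    obtain ⟨c, rfl⟩ := exists_eq_algebraMap hτ (F := F) fun z => by
      by_contra hz
      rw [ord_of_congrPM hF (hpole z (not_le.1 hz))] at hz
      exact hz (by simpa using hord)
    exact ⟨Polynomial.C c, by simp, by simp⟩
  | succ n ih =>
    -- `H` is finite at `β`, with value `c` say. The even function `H - c` vanishes there, hence to
    -- order at least `e`; multiplied by `X ^ (n + 1)`, it says that `F - c X ^ (n + 1)` has a pole
    -- of order at most `n e`.
    set H := F * (X ^ (n + 1))⁻¹ with hH
    have hFH : F = H * X ^ (n + 1) := by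
      rw [hH, inv_mul_cancel_right₀ (pow_ne_zero _ hX.ne_zero)]
    have hHe : reflect τ H = H := by
      rw [hH, map_mul, map_inv₀, map_pow, hF, hX.even]
    have h0 : ((0 : ℤ) : WithTop ℤ) ≤ ord β H := by
      rw [← le_ord_mul_pow_iff hX.ord_eq H 0 (n + 1), ← hFH, zero_add]
      exact hord
    obtain ⟨c, hc⟩ := exists_ord_sub_pos h0
    have hc' := hX.le_ord _ (by rw [map_sub, hHe, AlgHom.commutes]) hc
    rw [← le_ord_mul_pow_iff hX.ord_eq _ _ (n + 1)] at hc'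
    have hG : (H - algebraMap ℂ _ c) * X ^ (n + 1) = F - algebraMap ℂ _ c * X ^ (n + 1) := by
      rw [sub_mul, ← hFH]
    rw [hG] at hc'
    obtain ⟨P, hP, hFP⟩ := ih (F - algebraMap ℂ _ c * X ^ (n + 1))
      (by rw [map_sub, hF, map_mul, AlgHom.commutes, map_pow, hX.even])
      (fun z hz => by
        by_contra hz'
        refine hz.not_ge ((le_min ?_ ?_).trans (le_ord_sub _ _ _))
        · exact not_lt.1 fun h => hz' (hpole z h)
        · refine ord_mul_nonneg (ord_algebraMap_nonneg _ _) ?_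
          rw [ord_pow]
          exact nsmul_nonneg (not_lt.1 fun h => hz' (hX.congr_of_neg z h)) _)
      (by
        refine le_trans (le_of_eq ?_) hc'
        refine WithTop.coe_inj.2 ?_
        push_cast
        ring)
    refine ⟨P + Polynomial.C c * Polynomial.X ^ (n + 1), ?_, ?_⟩
    · refine (Polynomial.natDegree_add_le _ _).trans (max_le (hP.trans n.le_succ) ?_)
      exact Polynomial.natDegree_C_mul_X_pow_le c (n + 1)
    · rw [map_add, ← hFP]
      simp

theorem exists_neg_natCast_le_ord {z : ℂ} (F : EllField τ) :
    ∃ N : ℕ, ((-N : ℤ) : WithTop ℤ) ≤ ord z F := by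
  cases ord z F with
  | top => exact ⟨0, le_top⟩
  | coe k => exact ⟨(-k).toNat, WithTop.coe_le_coe.2 (by omega)⟩

/-- Poles of `F` away from the poles of `X` are cleared by a polynomial in `X`. -/
theorem IsEvenCoordinate.exists_clear_poles (hτ : 0 < τ.im) {X : EllField τ} {β : ℂ} {e : ℕ}
    (hX : IsEvenCoordinate X β e) (F : EllField τ) :
    ∃ Q : ℂ[X], Q ≠ 0 ∧ ∀ z, ord z (F * Polynomial.aeval X Q) < 0 → CongrPM τ β z := by
  have hXn : ∀ z, ¬ CongrPM τ β z → 0 ≤ ord z X := fun z hz =>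
    not_lt.1 fun h => hz (hX.congr_of_neg z h)
  -- Poles are removed one at a time: at a point `u` where `X` takes the finite value `c`, the
  -- factor `(X - c) ^ N` absorbs a pole of order at most `N`. It creates no pole at the other
  -- points, `X` being finite there.
  have key : ∀ S : Finset ℂ, ∃ Q : ℂ[X], Q ≠ 0 ∧
      ∀ w ∈ S, ¬ CongrPM τ β w → 0 ≤ ord w (F * Polynomial.aeval X Q) := by
    intro S
    induction S using Finset.induction_on with
    | empty => exact ⟨1, one_ne_zero, by simp⟩
    | insert u S _ ih =>
      obtain ⟨Q, hQ, hS⟩ := ih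
      by_cases hu : CongrPM τ β u
      · refine ⟨Q, hQ, fun w hw hw' => ?_⟩
        rcases Finset.mem_insert.1 hw with rfl | hw
        · exact absurd hu hw'
        · exact hS w hw hw'
      · obtain ⟨c, hc⟩ := exists_ord_sub_pos (hXn u hu)
        obtain ⟨N, hN⟩ := exists_neg_natCast_le_ord (z := u) (F * Polynomial.aeval X Q)
        refine ⟨Q * (Polynomial.X - Polynomial.C c) ^ N,
          mul_ne_zero hQ (pow_ne_zero _ (Polynomial.X_sub_C_ne_zero c)), fun w hw hw' => ?_⟩
        rw [map_mul, ← mul_assoc]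
        rcases Finset.mem_insert.1 hw with rfl | hw
        · have h1 : N • (1 : WithTop ℤ) ≤ N • ord w (X - algebraMap ℂ _ c) := by
            refine nsmul_le_nsmul_right ?_ N
            revert hc
            cases ord w (X - algebraMap ℂ (EllField τ) c) with
            | top => simp
            | coe k =>
              intro hc
              exact WithTop.coe_le_coe.2 (Int.add_one_le_iff.2 (WithTop.coe_lt_coe.1 hc))
          have h2 : ((-N : ℤ) : WithTop ℤ) + N • (1 : WithTop ℤ) = 0 := by
            rw [nsmul_one, WithTop.LinearOrderedAddCommGroup.coe_neg]
            simp
          rw [ord_mul, map_pow, ord_pow, map_sub, Polynomial.aeval_X, Polynomial.aeval_C, ← h2]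
          exact add_le_add hN h1
        · exact ord_mul_nonneg (hS w hw hw') (ord_aeval_nonneg (hXn w hw') _)
  obtain ⟨S, hS⟩ := exists_finset_poles hτ F
  obtain ⟨Q, hQ, hQS⟩ := key S
  refine ⟨Q, hQ, fun z hz => ?_⟩
  by_contra hz'
  by_cases hzF : ord z F < 0
  · obtain ⟨w, hw, n, hn⟩ := hS z hzF
    rw [ord_eq_of_ex _ hn] at hz
    exact hz.not_ge (hQS w hw fun h => hz' (h.of_period hn))
  · exact hz.not_ge (ord_mul_nonneg (not_lt.1 hzF) (ord_aeval_nonneg (hXn z hz') _))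

theorem aeval_mem_intermediateField {E : Type*} [Field E] [Algebra ℂ E]
    {K : IntermediateField ℂ E} {x : E} (hx : x ∈ K) (P : ℂ[X]) : Polynomial.aeval x P ∈ K :=
  Algebra.adjoin_le (S := K.toSubalgebra) (Set.singleton_subset_iff.2 hx)
    (Polynomial.aeval_mem_adjoin_singleton ℂ x)

/-- After clearing poles, `F · Q(X) = P(X)` with `Q(X) ≠ 0` by transcendence, so `F` is the quotient
`P(X) / Q(X)`. -/
theorem IsEvenCoordinate.mem_of_even (hτ : 0 < τ.im) {X : EllField τ} {β : ℂ} {e : ℕ}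
    (hX : IsEvenCoordinate X β e) {K : IntermediateField ℂ (EllField τ)} (hK : X ∈ K)
    {F : EllField τ} (hF : reflect τ F = F) : F ∈ K := by
  obtain ⟨Q, hQ, hpole⟩ := hX.exists_clear_poles hτ F
  obtain ⟨N, hN⟩ := exists_neg_natCast_le_ord (z := β) (F * Polynomial.aeval X Q)
  obtain ⟨P, -, hP⟩ := hX.exists_eq_aeval hτ N _
    (by rw [map_mul, hF, reflect_aeval hX.even]) hpole
    (le_trans (WithTop.coe_le_coe.2 (by have := hX.pos; nlinarith)) hN)
  have hQX : Polynomial.aeval X Q ≠ 0 :=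
    fun h => hQ ((transcendental_iff.1 (transcendental_of_ord_neg hX.ord_neg)) Q h)
  rw [← eq_div_iff hQX] at hP
  rw [hP]
  exact K.div_mem (aeval_mem_intermediateField hK P) (aeval_mem_intermediateField hK Q)

/-- An even coordinate and any non-zero odd function generate the field. -/
theorem IsEvenCoordinate.adjoin_eq_top (hτ : 0 < τ.im) {X : EllField τ} {β : ℂ} {e : ℕ}
    (hX : IsEvenCoordinate X β e) {Y : EllField τ} (hY : reflect τ Y = -Y) (hY0 : Y ≠ 0) :
    IntermediateField.adjoin ℂ {X, Y} = ⊤ := by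
  rw [eq_top_iff]
  intro F _
  set K := IntermediateField.adjoin ℂ {X, Y}
  have hXK : X ∈ K := IntermediateField.subset_adjoin ℂ _ (by simp)
  have hYK : Y ∈ K := IntermediateField.subset_adjoin ℂ _ (by simp)
  -- Both the even part of `F` and its odd part divided by the odd function `Y` are even.
  have h1 : F + reflect τ F ∈ K := hX.mem_of_even hτ hXK (by
    rw [map_add, reflect_reflect, add_comm])
  have h2 : (F - reflect τ F) / Y ∈ K := hX.mem_of_even hτ hXK (by
    rw [map_div₀, map_sub, reflect_reflect, hY, div_neg, ← neg_div, neg_sub])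
  have h3 : F = algebraMap ℂ _ (1 / 2) * (F + reflect τ F + (F - reflect τ F) / Y * Y) := by
    rw [div_mul_cancel₀ _ hY0, add_add_sub_cancel, ← two_mul, ← mul_assoc,
      ← map_ofNat (algebraMap ℂ (EllField τ)) 2, ← map_mul]
    norm_num
  rw [h3]
  exact K.mul_mem (K.algebraMap_mem _) (K.add_mem h1 (K.mul_mem h2 hYK))

end EllipticFunctions

namespace EllipticFunctions

open Complex Filter Topology

/-! ### The elliptic functions `X` and `Y` -/

variable {τ : ℂ}

/-- The elliptic function `X`. -/
def ellX (hτ : 0 < τ.im) {a b : ℂ} (ha : a ≠ 0) (hb : b ≠ 0) : EllField τ :=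
  toEll τ ⟨_, funX_ex_mem hτ ha hb⟩

/-- The elliptic function `Y`. -/
def ellY (hτ : 0 < τ.im) {b : ℂ} (hb : b ≠ 0) : EllField τ :=
  toEll τ ⟨_, funY_ex_mem hτ hb⟩

theorem reflect_ellX (hτ : 0 < τ.im) {a b : ℂ} (ha : a ≠ 0) (hb : b ≠ 0) :
    reflect τ (ellX hτ ha hb) = ellX hτ ha hb := by
  rw [ellX, reflect_toEll]
  congr 1
  ext z
  change funX a b (ex τ) (ex (-z)) = funX a b (ex τ) (ex z)
  rw [ex_neg, funX_inv]

theorem reflect_ellY (hτ : 0 < τ.im) {b : ℂ} (hb : b ≠ 0) :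
    reflect τ (ellY hτ hb) = -ellY hτ hb := by
  rw [ellY, reflect_toEll, ← map_neg]
  congr 1
  ext z
  change funY b (ex τ) (ex (-z)) = -funY b (ex τ) (ex z)
  rw [ex_neg, funY_inv (norm_ex_lt_one hτ) b (ex_ne_zero z)]

theorem order_thetaPM_ex_ne_top (hτ : 0 < τ.im) (β : ℂ) :
    meromorphicOrderAt (fun w => thetaPM (ex β) (ex w) (ex τ)) β ≠ ⊤ := by
  by_cases h : ∃ n : ℤ, ex β ^ 2 = ex τ ^ n
  · obtain ⟨n, hn⟩ := h
    rw [order_thetaPM_ex_double hτ hn]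
    exact WithTop.coe_ne_top
  · push Not at h
    rw [order_thetaPM_ex_simple hτ h]
    exact WithTop.coe_ne_top

theorem order_theta_ex_ne_top (hτ : 0 < τ.im) (z : ℂ) :
    meromorphicOrderAt (fun w => theta (ex w) (ex τ)) z ≠ ⊤ := by
  by_cases h : ∃ n : ℤ, ex z = ex τ ^ n
  · obtain ⟨n, hn⟩ := h
    rw [order_theta_ex hτ hn]
    exact WithTop.coe_ne_top
  · push Not at h
    rw [order_theta_ex_of_ne hτ h]
    exact WithTop.coe_ne_top

/-- It suffices that the order at one point is finite. At `β` neither the numerator, which is theta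
after `z ↦ 2z`, nor the denominator vanishes identically. -/
theorem ellY_ne_zero (hτ : 0 < τ.im) {b : ℂ} (hb : b ≠ 0) : ellY hτ hb ≠ 0 := by
  obtain ⟨β, rfl⟩ := exists_ex_eq hb
  have hn := analyticAt_theta_ex_sq hτ β
  have hd := analyticAt_thetaPM_ex hτ (ex β) β
  have he : AnalyticAt ℂ ex β := differentiable_ex.analyticAt β
  have h1 : meromorphicOrderAt (fun w => theta (ex w ^ 2) (ex τ)) β ≠ ⊤ := by
    have hd : HasDerivAt (fun w : ℂ => 2 * w) 2 β := by
      simpa using (hasDerivAt_id β).const_mul (2 : ℂ)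
    have := meromorphicOrderAt_comp_of_deriv_ne_zero (f := fun w => theta (ex w) (ex τ))
      (g := fun w => 2 * w) (x := β) (by fun_prop) (by rw [hd.deriv]; norm_num)
    have h2 : (fun w => theta (ex w ^ 2) (ex τ)) =
        (fun w => theta (ex w) (ex τ)) ∘ fun w => 2 * w := by
      ext w
      simp [two_mul, ex_add, sq]
    rw [h2, this]
    exact order_theta_ex_ne_top hτ _
  have h2 : meromorphicOrderAt (fun w => (ex w * thetaPM (ex β) (ex w) (ex τ) ^ 2)⁻¹) β ≠ ⊤ := by
    obtain ⟨k, hk⟩ := WithTop.ne_top_iff_exists.1 (order_thetaPM_ex_ne_top hτ β)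
    have h3 := meromorphicOrderAt_mul_of_ne_zero
      (f := fun w => thetaPM (ex β) (ex w) (ex τ) ^ 2) he (ex_ne_zero β)
    have h4 := meromorphicOrderAt_mul hd.meromorphicAt hd.meromorphicAt
    have h5 : (fun w => thetaPM (ex β) (ex w) (ex τ) ^ 2) =
        (fun w => thetaPM (ex β) (ex w) (ex τ)) * fun w => thetaPM (ex β) (ex w) (ex τ) := by
      ext w
      exact sq _
    rw [← hk] at h4
    rw [h5, h4] at h3
    have h6 := (meromorphicOrderAt_inv (f := ex * ((fun w => thetaPM (ex β) (ex w) (ex τ)) *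
      fun w => thetaPM (ex β) (ex w) (ex τ))) (x := β)).trans (congr_arg Neg.neg h3)
    have h7 : (fun w => (ex w * thetaPM (ex β) (ex w) (ex τ) ^ 2)⁻¹) =
        (ex * ((fun w => thetaPM (ex β) (ex w) (ex τ)) *
          fun w => thetaPM (ex β) (ex w) (ex τ)))⁻¹ := by
      ext w
      simp [sq]
    rw [h7, h6, ← WithTop.coe_add, ← WithTop.LinearOrderedAddCommGroup.coe_neg]
    exact WithTop.coe_ne_top
  intro h
  rw [← ord_eq_top_iff (z := β), ellY, ord_toEll] at h
  have h3 := meromorphicOrderAt_mul hn.meromorphicAt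
    ((he.mul (hd.pow 2)).meromorphicAt.inv)
  have h4 := h3.symm.trans h
  rw [WithTop.add_eq_top] at h4
  exact h4.elim h1 h2

/-! ### `X` as an even coordinate -/

theorem analyticAt_funX_ex (hτ : 0 < τ.im) {a b z : ℂ} (h : thetaPM b (ex z) (ex τ) ≠ 0) :
    AnalyticAt ℂ (fun w => funX a b (ex τ) (ex w)) z :=
  (analyticAt_thetaPM_ex hτ a z).div (analyticAt_thetaPM_ex hτ b z) h

theorem thetaPM_ex_ne_zero_of_not_congrPM (hτ : 0 < τ.im) {β z : ℂ} (h : ¬ CongrPM τ β z) :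
    thetaPM (ex β) (ex z) (ex τ) ≠ 0 := by
  refine thetaPM_ne_zero (norm_ex_lt_one hτ) (ex_ne_zero _) (ex_ne_zero _) (ex_ne_zero _)
    (fun n hn => h ⟨n, .inr ?_⟩) (fun n hn => h ⟨-n, .inl ?_⟩)
  · rw [← hn, ex_neg, inv_mul_cancel_left₀ (ex_ne_zero β)]
  · rw [zpow_neg, ← hn, inv_div, mul_div_cancel₀ _ (ex_ne_zero β)]

/-- The conditions on `a * ex β` and `a / ex β` keep the numerator from vanishing at `β`, so the
pole order is exactly the order of the zero of the denominator. -/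
theorem isEvenCoordinate_ellX_aux (hτ : 0 < τ.im) {a β : ℂ} (ha : a ≠ 0)
    (h1 : ∀ n : ℤ, a * ex β ≠ ex τ ^ n) (h2 : ∀ n : ℤ, a / ex β ≠ ex τ ^ n) {e : ℕ} (he : 0 < e)
    (hord : meromorphicOrderAt (fun w => thetaPM (ex β) (ex w) (ex τ)) β = ((e : ℤ) : WithTop ℤ))
    (hle : ∀ G : EllField τ, reflect τ G = G → 0 < ord β G → ((e : ℤ) : WithTop ℤ) ≤ ord β G) :
    IsEvenCoordinate (ellX hτ ha (ex_ne_zero β)) β e where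
  even := reflect_ellX hτ ha _
  pos := he
  ord_eq := by
    rw [ellX, ord_toEll]
    have h := meromorphicOrderAt_div (analyticAt_thetaPM_ex hτ a β).meromorphicAt
      (analyticAt_thetaPM_ex hτ (ex β) β).meromorphicAt
    rw [order_thetaPM_ex_of_ne hτ ha h1 h2, hord, zero_sub] at h
    exact h
  congr_of_neg z hz := by
    by_contra hz'
    rw [ellX, ord_toEll] at hz
    exact hz.not_ge (analyticAt_funX_ex hτ
      (thetaPM_ex_ne_zero_of_not_congrPM hτ hz')).meromorphicOrderAt_nonneg
  le_ord := hle

theorem isEvenCoordinate_ellX_double (hτ : 0 < τ.im) {a β : ℂ} (ha : a ≠ 0)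
    (h1 : ∀ n : ℤ, a * ex β ≠ ex τ ^ n) (h2 : ∀ n : ℤ, a / ex β ≠ ex τ ^ n) {n : ℤ}
    (hβ : ex β ^ 2 = ex τ ^ n) : IsEvenCoordinate (ellX hτ ha (ex_ne_zero β)) β 2 :=
  isEvenCoordinate_ellX_aux hτ ha h1 h2 two_pos (order_thetaPM_ex_double hτ hβ)
    fun _ hG h => two_le_ord_of_even hG hβ h

theorem exists_isEvenCoordinate_ellX (hτ : 0 < τ.im) {a β : ℂ} (ha : a ≠ 0)
    (h1 : ∀ n : ℤ, a * ex β ≠ ex τ ^ n) (h2 : ∀ n : ℤ, a / ex β ≠ ex τ ^ n) :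
    ∃ e, IsEvenCoordinate (ellX hτ ha (ex_ne_zero β)) β e := by
  by_cases h : ∃ n : ℤ, ex β ^ 2 = ex τ ^ n
  · obtain ⟨n, hn⟩ := h
    exact ⟨2, isEvenCoordinate_ellX_double hτ ha h1 h2 hn⟩
  · push Not at h
    refine ⟨1, isEvenCoordinate_ellX_aux hτ ha h1 h2 one_pos (order_thetaPM_ex_simple hτ h)
      fun G _ hG => ?_⟩
    revert hG
    cases ord β G with
    | top => simp
    | coe k => exact fun hG => WithTop.coe_le_coe.2 (Int.add_one_le_iff.2 (WithTop.coe_lt_coe.1 hG))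

theorem adjoin_ellX_ellY (hτ : 0 < τ.im) {a b : ℂ} (ha : a ≠ 0) (hb : b ≠ 0)
    (h1 : ∀ n : ℤ, a * b ≠ ex τ ^ n) (h2 : ∀ n : ℤ, a / b ≠ ex τ ^ n) :
    IntermediateField.adjoin ℂ {ellX hτ ha hb, ellY hτ hb} = ⊤ := by
  obtain ⟨β, rfl⟩ := exists_ex_eq hb
  obtain ⟨e, he⟩ := exists_isEvenCoordinate_ellX hτ ha h1 h2
  exact he.adjoin_eq_top hτ (reflect_ellY hτ _) (ellY_ne_zero hτ _)

/-! ### Half periods -/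

theorem ex_half_sq (τ : ℂ) : ex (τ / 2) ^ 2 = ex τ := by
  rw [sq, ← ex_add, add_halves]

theorem norm_ex_half_lt_one (hτ : 0 < τ.im) : ‖ex (τ / 2)‖ < 1 :=
  norm_ex_lt_one (by simpa using hτ)

theorem zpow_ex_injective (hτ : 0 < τ.im) : Function.Injective fun n : ℤ => ex τ ^ n := by
  intro m n h
  have h1 := congr_arg norm h
  simp only [norm_zpow] at h1
  exact zpow_right_injective₀ (norm_pos_iff.2 (ex_ne_zero τ)) (norm_ex_lt_one hτ).ne h1

/-- The four values of `x` at the half periods. -/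
def halfPts (τ : ℂ) : Finset ℂ := {1, -1, ex (τ / 2), -ex (τ / 2)}

theorem exists_sq_eq_of_mem_halfPts {u : ℂ} (hu : u ∈ halfPts τ) :
    ∃ i : ℤ, (i = 0 ∨ i = 1) ∧ u ^ 2 = ex τ ^ i := by
  simp only [halfPts, Finset.mem_insert, Finset.mem_singleton] at hu
  rcases hu with rfl | rfl | rfl | rfl
  · exact ⟨0, by simp⟩
  · exact ⟨0, by simp⟩
  · exact ⟨1, by simp [ex_half_sq]⟩
  · exact ⟨1, by simp [ex_half_sq]⟩

theorem ne_zero_of_mem_halfPts {u : ℂ} (hu : u ∈ halfPts τ) : u ≠ 0 := by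
  obtain ⟨i, -, hi⟩ := exists_sq_eq_of_mem_halfPts hu
  rintro rfl
  exact zpow_ne_zero i (ex_ne_zero τ) (by rw [← hi]; simp)

/-- Squaring `u = v pⁿ` and comparing exponents gives `i = 2n + j` with `i, j ∈ {0, 1}`, which
forces `n = 0` and `u = v`. -/
theorem div_ne_zpow_of_mem_halfPts (hτ : 0 < τ.im) {u v : ℂ} (hu : u ∈ halfPts τ)
    (hv : v ∈ halfPts τ) (huv : u ≠ v) (n : ℤ) : u / v ≠ ex τ ^ n := by
  intro h
  have hv0 := ne_zero_of_mem_halfPts hv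
  obtain ⟨i, hi, hui⟩ := exists_sq_eq_of_mem_halfPts hu
  obtain ⟨j, hj, hvj⟩ := exists_sq_eq_of_mem_halfPts hv
  rw [div_eq_iff hv0] at h
  have h1 : ex τ ^ i = ex τ ^ (n + n + j) := by
    rw [← hui, h, zpow_add₀ (ex_ne_zero τ), zpow_add₀ (ex_ne_zero τ), ← hvj]
    ring
  have h2 := zpow_ex_injective hτ h1
  obtain rfl : n = 0 := by omega
  exact huv (by simpa using h)

theorem mul_ne_zpow_of_mem_halfPts (hτ : 0 < τ.im) {u v : ℂ} (hu : u ∈ halfPts τ)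
    (hv : v ∈ halfPts τ) (huv : u ≠ v) (n : ℤ) : u * v ≠ ex τ ^ n := by
  intro h
  have hv0 := ne_zero_of_mem_halfPts hv
  obtain ⟨j, -, hvj⟩ := exists_sq_eq_of_mem_halfPts hv
  refine div_ne_zpow_of_mem_halfPts hτ hu hv huv (n - j) ?_
  rw [zpow_sub₀ (ex_ne_zero τ), ← h, ← hvj]
  field_simp

theorem thetaPM_ne_zero_of_mem_halfPts (hτ : 0 < τ.im) {u v : ℂ} (hu : u ∈ halfPts τ)
    (hv : v ∈ halfPts τ) (huv : u ≠ v) : thetaPM u v (ex τ) ≠ 0 :=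
  thetaPM_ne_zero (norm_ex_lt_one hτ) (ex_ne_zero τ) (ne_zero_of_mem_halfPts hu)
    (ne_zero_of_mem_halfPts hv) (mul_ne_zpow_of_mem_halfPts hτ hu hv huv)
    (div_ne_zpow_of_mem_halfPts hτ hu hv huv)

theorem halfPts_distinct (hτ : 0 < τ.im) :
    (1 : ℂ) ≠ -1 ∧ (1 : ℂ) ≠ ex (τ / 2) ∧ (1 : ℂ) ≠ -ex (τ / 2) ∧ (-1 : ℂ) ≠ ex (τ / 2) ∧
      (-1 : ℂ) ≠ -ex (τ / 2) ∧ ex (τ / 2) ≠ -ex (τ / 2) := by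
  have h := norm_ex_half_lt_one hτ
  have h0 := ex_ne_zero (τ / 2)
  refine ⟨by norm_num, fun h1 => ?_, fun h1 => ?_, fun h1 => ?_, fun h1 => ?_, fun h1 => ?_⟩
  · exact h.ne (by rw [← h1]; simp)
  · exact h.ne (by rw [← norm_neg, ← h1]; simp)
  · exact h.ne (by rw [← h1]; simp)
  · exact h.ne (by rw [← norm_neg, ← h1]; simp)
  · exact h0 (self_eq_neg.1 h1)

theorem theta_p_div {p : ℂ} (hp0 : p ≠ 0) (x : ℂ) : theta (p / x) p = theta x p := by
  rw [theta, theta, div_div_cancel₀ hp0, mul_comm]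

/-- At a half period the two factors of `θ(u x^±)` coincide up to a monomial, by inversion or by
`θ(p / x) = θ(x)`, so each product is essentially a square. Together they are the square of the
right side of `theta_sq`; the factor `-x²` compensates for `u = 1` and `u = -1`. -/
theorem prod_thetaPM_halfPts (hτ : 0 < τ.im) {x : ℂ} (hx : x ≠ 0) :
    theta (x ^ 2) (ex τ) ^ 2 = -x ^ 2 * ∏ u ∈ halfPts τ, thetaPM u x (ex τ) := by
  obtain ⟨h1, h2, h3, h4, h5, h6⟩ := halfPts_distinct hτ
  have hs0 := ex_ne_zero (τ / 2)
  have hp := norm_ex_lt_one hτ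
  have hp0 := ex_ne_zero τ
  rw [halfPts, Finset.prod_insert (by simp [h1, h2, h3]), Finset.prod_insert (by simp [h4, h5]),
    Finset.prod_insert (by simpa using h6), Finset.prod_singleton]
  have e1 : thetaPM 1 x (ex τ) = -theta x (ex τ) ^ 2 / x := by
    rw [thetaPM, one_mul, one_div, theta_inv hp hx]
    ring
  have e2 : thetaPM (-1) x (ex τ) = theta (-x) (ex τ) ^ 2 / x := by
    rw [thetaPM, neg_one_mul, neg_div, one_div, ← inv_neg, theta_inv hp (neg_ne_zero.2 hx)]
    field_simp
  have e3 : thetaPM (ex (τ / 2)) x (ex τ) = theta (ex (τ / 2) * x) (ex τ) ^ 2 := by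
    rw [thetaPM, sq, ← theta_p_div hp0 (ex (τ / 2) / x), ← ex_half_sq τ]
    congr 2
    field_simp
  have e4 : thetaPM (-ex (τ / 2)) x (ex τ) = theta (-(ex (τ / 2) * x)) (ex τ) ^ 2 := by
    rw [thetaPM, sq, ← theta_p_div hp0 (-ex (τ / 2) / x), neg_mul, ← ex_half_sq τ]
    congr 2
    field_simp
  have e5 := theta_sq (norm_ex_half_lt_one hτ) hs0 hx
  rw [ex_half_sq] at e5
  rw [e1, e2, e3, e4, e5]
  field_simp

/-! ### Algebraic relations between the functions attached to half periods -/

section HalfPeriods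

variable {a b c d : ℂ}

theorem toFinset_eq_halfPts
    (h : ({a, b, c, d} : Set ℂ) = {1, -1, ex (τ / 2), -ex (τ / 2)}) :
    ({a, b, c, d} : Multiset ℂ).toFinset = halfPts τ := by
  ext x
  have := Set.ext_iff.1 h x
  simpa [halfPts] using this

/-- Four listed values that exhaust a set of four elements are distinct, so the equality of sets
alone already encodes distinctness. -/
theorem nodup_of_eq_halfPts (hτ : 0 < τ.im)
    (h : ({a, b, c, d} : Multiset ℂ).toFinset = halfPts τ) :
    ({a, b, c, d} : Multiset ℂ).Nodup := by
  rw [← Multiset.toFinset_card_eq_card_iff_nodup, h]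
  obtain ⟨h1, h2, h3, h4, h5, h6⟩ := halfPts_distinct hτ
  rw [halfPts, Finset.card_insert_of_notMem (by simp [h1, h2, h3]),
    Finset.card_insert_of_notMem (by simp [h4, h5]),
    Finset.card_insert_of_notMem (by simpa using h6), Finset.card_singleton]
  simp

theorem ellY_sq (hτ : 0 < τ.im) (ha : a ≠ 0) (hb : b ≠ 0) (hc : c ≠ 0) (hd : d ≠ 0)
    (h : ({a, b, c, d} : Multiset ℂ).toFinset = halfPts τ) :
    ellY hτ hb ^ 2 = -(ellX hτ ha hb * ellX hτ hc hb * ellX hτ hd hb) := by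
  have hnd := nodup_of_eq_halfPts hτ h
  rw [ellY, ellX, ellX, ellX, ← map_pow, ← map_mul, ← map_mul, ← map_neg]
  congr 1
  ext z
  change funY b (ex τ) (ex z) ^ 2 = -(funX a b (ex τ) (ex z) * funX c b (ex τ) (ex z) *
    funX d b (ex τ) (ex z))
  have h1 := prod_thetaPM_halfPts hτ (ex_ne_zero z)
  rw [← h, Finset.prod_eq_multiset_prod, Multiset.toFinset_val, hnd.dedup] at h1
  simp only [Multiset.insert_eq_cons, Multiset.map_cons, Multiset.map_singleton,
    Multiset.prod_cons, Multiset.prod_singleton] at h1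
  rw [funY, div_pow, h1, funX, funX, funX]
  have := ex_ne_zero z
  -- At zeros of the denominator both sides are `0` by the convention for division.
  by_cases hT : thetaPM b (ex z) (ex τ) = 0
  · simp [hT]
  · field_simp

/-- For half periods, `X_{a,b}` is affine in `X_{c,b}`. -/
theorem exists_ellX_sub_eq (hτ : 0 < τ.im) (ha : a ∈ halfPts τ) (hb : b ∈ halfPts τ)
    (hc : c ∈ halfPts τ) (hab : a ≠ b) (hcb : c ≠ b) :
    ∃ k : ℂ, k ≠ 0 ∧ ellX hτ (ne_zero_of_mem_halfPts ha) (ne_zero_of_mem_halfPts hb) -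
      algebraMap ℂ _ (funX a b (ex τ) c) =
        algebraMap ℂ _ k * ellX hτ (ne_zero_of_mem_halfPts hc) (ne_zero_of_mem_halfPts hb) := by
  obtain ⟨β, rfl⟩ := exists_ex_eq (ne_zero_of_mem_halfPts hb)
  obtain ⟨γ, rfl⟩ := exists_ex_eq (ne_zero_of_mem_halfPts hc)
  obtain ⟨n, -, hn⟩ := exists_sq_eq_of_mem_halfPts hb
  have hX := isEvenCoordinate_ellX_double hτ (ne_zero_of_mem_halfPts ha)
    (mul_ne_zpow_of_mem_halfPts hτ ha hb hab) (div_ne_zpow_of_mem_halfPts hτ ha hb hab) hn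
  have hZ := isEvenCoordinate_ellX_double hτ (ne_zero_of_mem_halfPts hc)
    (mul_ne_zpow_of_mem_halfPts hτ hc hb hcb) (div_ne_zpow_of_mem_halfPts hτ hc hb hcb) hn
  set X := ellX hτ (ne_zero_of_mem_halfPts ha) (ex_ne_zero β) with hXdef
  set Z := ellX hτ (ne_zero_of_mem_halfPts hc) (ex_ne_zero β) with hZdef
  -- The pole of `X` is no worse than that of `Z`, so the polynomial has degree at most `1`.
  obtain ⟨P, hP, hXP⟩ := hZ.exists_eq_aeval hτ 1 X hX.even hX.congr_of_neg
    (by rw [hX.ord_eq]; simp)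
  obtain ⟨k, m, rfl⟩ := Polynomial.exists_eq_X_add_C_of_natDegree_le_one hP
  simp only [map_add, map_mul, Polynomial.aeval_C, Polynomial.aeval_X] at hXP
  have hT := thetaPM_ne_zero_of_mem_halfPts hτ hb hc hcb.symm
  have h1 : 0 < ord γ (X - algebraMap ℂ _ (funX a (ex β) (ex τ) (ex γ))) :=
    ord_sub_apply_pos (f := ⟨_, funX_ex_mem hτ (ne_zero_of_mem_halfPts ha) (ex_ne_zero β)⟩)
      (analyticAt_funX_ex hτ hT).continuousAt
  have h2 : 0 < ord γ (Z - algebraMap ℂ _ (funX (ex γ) (ex β) (ex τ) (ex γ))) :=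
    ord_sub_apply_pos (f := ⟨_, funX_ex_mem hτ (ne_zero_of_mem_halfPts hc) (ex_ne_zero β)⟩)
      (analyticAt_funX_ex hτ hT).continuousAt
  have h3 : funX (ex γ) (ex β) (ex τ) (ex γ) = 0 := by
    rw [funX, thetaPM_self (norm_ex_lt_one hτ) (ex_ne_zero γ), zero_div]
  rw [h3, map_zero, sub_zero] at h2
  -- `Z` vanishes at `γ`, so the constant term is the value of `X` there.
  have hm : m = funX a (ex β) (ex τ) (ex γ) := by
    by_contra hm
    have h4 : X - algebraMap ℂ _ (funX a (ex β) (ex τ) (ex γ)) - algebraMap ℂ _ k * Z =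
        algebraMap ℂ _ (m - funX a (ex β) (ex τ) (ex γ)) := by
      rw [hXP, map_sub]
      ring
    have h5 : 0 < ord γ (algebraMap ℂ (EllField τ) k * Z) := by
      rw [ord_mul]
      exact h2.trans_le (le_add_of_nonneg_left (ord_algebraMap_nonneg _ _))
    have h6 := (lt_min h1 h5).trans_le (le_ord_sub _ _ _)
    rw [h4, ord_algebraMap γ (sub_ne_zero.2 hm)] at h6
    exact lt_irrefl _ h6
  refine ⟨k, ?_, ?_⟩
  · rintro rfl
    rw [map_zero, zero_mul, zero_add] at hXP
    have := hX.ord_neg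
    rw [hXP] at this
    exact this.not_ge (ord_algebraMap_nonneg _ _)
  · rw [← hm, hXP]
    ring

end HalfPeriods

/-! ### The Legendre field -/

/-- The kernel of evaluation at `(X, Y)` meets `ℂ[X]` trivially by transcendence. The coordinate
ring is a domain integral over `ℂ[X]`, so the kernel is zero and the map extends to fractions.
Nothing is needed about `l`, since the Legendre polynomial is irreducible for every `l`. -/
theorem exists_legendreField_equiv {E : Type*} [Field E] [Algebra ℂ E] {X Y : E} {l : ℂ}
    (hX : Transcendental ℂ X)
    (hXY : Y ^ 2 = X * (X - 1) * (X - algebraMap ℂ E l))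
    (htop : IntermediateField.adjoin ℂ {X, Y} = ⊤) :
    ∃ φ : LegendreField l ≃ₐ[ℂ] E, φ (legendreX l) = X ∧ φ (legendreY l) = Y := by
  have hroot : (legendrePoly l).eval₂ (Polynomial.aeval X : ℂ[X] →ₐ[ℂ] E) Y = 0 := by
    simp [legendrePoly, hXY]
  let ψ : AdjoinRoot (legendrePoly l) →ₐ[ℂ] E :=
    AdjoinRoot.liftAlgHom (legendrePoly l) (Polynomial.aeval X) Y hroot
  have hψX : ψ (AdjoinRoot.of _ Polynomial.X) = X := by simp [ψ]
  have hψY : ψ (AdjoinRoot.root _) = Y := by simp [ψ]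
  have hmonic : (legendrePoly l).Monic := by
    unfold legendrePoly
    monicity!
  have hψ : Function.Injective ψ := by
    rw [← AlgHom.coe_toRingHom, RingHom.injective_iff_ker_eq_bot]
    have : Algebra.IsIntegral ℂ[X] (AdjoinRoot (legendrePoly l)) := by
      have := hmonic.finite_adjoinRoot
      infer_instance
    refine Ideal.eq_bot_of_comap_eq_bot (R := ℂ[X]) ?_
    rw [eq_bot_iff]
    intro P hP
    rw [Ideal.mem_comap, RingHom.mem_ker] at hP
    have h1 : Polynomial.aeval X P = 0 := by
      rw [← hP]
      change _ = ψ (AdjoinRoot.of _ P)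
      simp [ψ]
    exact (transcendental_iff.1 hX) P h1
  let Φ : LegendreField l →ₐ[ℂ] E := IsFractionRing.liftAlgHom (g := ψ) hψ
  have hΦ : ∀ r, Φ (algebraMap _ _ r) = ψ r := fun r => IsFractionRing.lift_algebraMap hψ r
  have hΦX : Φ (legendreX l) = X := by rw [legendreX, hΦ, hψX]
  have hΦY : Φ (legendreY l) = Y := by rw [legendreY, hΦ, hψY]
  have hsurj : Function.Surjective Φ := by
    rw [← AlgHom.fieldRange_eq_top, eq_top_iff, ← htop, IntermediateField.adjoin_le_iff]
    rintro _ (rfl | rfl)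
    · exact ⟨_, hΦX⟩
    · exact ⟨_, hΦY⟩
  exact ⟨AlgEquiv.ofBijective Φ ⟨Φ.injective, hsurj⟩, hΦX, hΦY⟩

end EllipticFunctions

namespace EllipticFunctions

/-! ### The isomorphism for half periods -/

variable {τ : ℂ}

theorem exists_equiv_of_halfPts (hτ : 0 < τ.im) {a b c d : ℂ}
    (h : ({a, b, c, d} : Multiset ℂ).toFinset = halfPts τ) (ha0 : a ≠ 0) (hb0 : b ≠ 0) :
    funX a b (ex τ) c ≠ 0 ∧ ∃ κ : ℂ, κ ≠ 0 ∧
      ∃ φ : LegendreField (funX a b (ex τ) d / funX a b (ex τ) c) ≃ₐ[ℂ] EllField τ,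
        φ (legendreX _) = (funX a b (ex τ) c)⁻¹ • ellX hτ ha0 hb0 ∧
        φ (legendreY _) = κ • ellY hτ hb0 := by
  have hnd := nodup_of_eq_halfPts hτ h
  simp only [Multiset.insert_eq_cons, Multiset.nodup_cons, Multiset.mem_cons,
    Multiset.mem_singleton, Multiset.nodup_singleton, not_or] at hnd
  obtain ⟨⟨hab, hac, -⟩, ⟨hbc, hbd⟩, -, -⟩ := hnd
  have ha : a ∈ halfPts τ := by rw [← h]; simp
  have hb : b ∈ halfPts τ := by rw [← h]; simp
  have hc : c ∈ halfPts τ := by rw [← h]; simp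
  have hd : d ∈ halfPts τ := by rw [← h]; simp
  have hA : funX a b (ex τ) c ≠ 0 :=
    div_ne_zero (thetaPM_ne_zero_of_mem_halfPts hτ ha hc hac)
      (thetaPM_ne_zero_of_mem_halfPts hτ hb hc hbc)
  refine ⟨hA, ?_⟩
  obtain ⟨k, hk, hXk⟩ := exists_ellX_sub_eq hτ ha hb hc hab (Ne.symm hbc)
  obtain ⟨m, hm, hXm⟩ := exists_ellX_sub_eq hτ ha hb hd hab (Ne.symm hbd)
  have hY := ellY_sq hτ ha0 hb0 (ne_zero_of_mem_halfPts hc) (ne_zero_of_mem_halfPts hd) h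
  have htop := adjoin_ellX_ellY hτ ha0 hb0 (mul_ne_zpow_of_mem_halfPts hτ ha hb hab)
    (div_ne_zpow_of_mem_halfPts hτ ha hb hab)
  have htrans : Transcendental ℂ (ellX hτ ha0 hb0) := by
    obtain ⟨β, rfl⟩ := exists_ex_eq hb0
    obtain ⟨e, he⟩ := exists_isEvenCoordinate_ellX hτ ha0
      (mul_ne_zpow_of_mem_halfPts hτ ha hb hab) (div_ne_zpow_of_mem_halfPts hτ ha hb hab)
    exact transcendental_of_ord_neg he.ord_neg
  set A := funX a b (ex τ) c
  set B := funX a b (ex τ) d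
  set X := ellX hτ ha0 hb0
  set Y := ellY hτ hb0
  -- From `X - A = k X_{c,b}` and `X - B = m X_{d,b}` comes `X (X - A)(X - B) = -k m Y²`. Dividing
  -- by `A³` gives the Legendre equation for `A⁻¹ X` and shows what `κ²` must be.
  obtain ⟨κ, hκ⟩ := IsAlgClosed.exists_pow_nat_eq (-(k * m) / A ^ 3) two_pos
  have hκ0 : κ ≠ 0 := by
    rintro rfl
    rw [zero_pow two_ne_zero, eq_comm, div_eq_zero_iff, neg_eq_zero, mul_eq_zero] at hκ
    exact hκ.elim (fun h => h.elim hk hm) (pow_ne_zero 3 hA)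
  refine ⟨κ, hκ0, exists_legendreField_equiv ?_ ?_ ?_⟩
  · intro halg
    refine htrans ?_
    have := halg.smul A
    rwa [smul_inv_smul₀ hA] at this
  · have hA' : algebraMap ℂ (EllField τ) A ≠ 0 := by
      rwa [Ne, map_eq_zero]
    have h1 : Y ^ 2 * (algebraMap ℂ _ k * algebraMap ℂ _ m) =
        -(X * (X - algebraMap ℂ _ A) * (X - algebraMap ℂ _ B)) := by
      rw [hXk, hXm, hY]
      ring
    rw [Algebra.smul_def, Algebra.smul_def, mul_pow, ← map_pow, hκ, map_div₀, map_div₀, map_inv₀,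
      map_neg, map_mul, map_pow]
    field_simp
    linear_combination -h1
  · rw [eq_top_iff, ← htop, IntermediateField.adjoin_le_iff]
    set K := IntermediateField.adjoin ℂ {A⁻¹ • X, κ • Y}
    have hX : A⁻¹ • X ∈ K := IntermediateField.subset_adjoin ℂ _ (by simp)
    have hY : κ • Y ∈ K := IntermediateField.subset_adjoin ℂ _ (by simp)
    rintro _ (rfl | rfl)
    · have := K.smul_mem hX (x := A)
      rwa [smul_inv_smul₀ hA] at this
    · have := K.smul_mem hY (x := κ⁻¹)
      rwa [inv_smul_smul₀ hκ0] at this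

/-- With `s = √p`, both values reduce to `θ(-1)` and `θ(-s)`, and their quotient is `s θ(-1)⁴ /
θ(-s)⁴`. Here `θ(-1) = 2 (-p; p)_∞²` supplies the constant `16 = 2⁴`, and `θ(-s) = (-s; p)_∞²`. -/
theorem funX_div_funX_eq_lambdaInv (hτ : 0 < τ.im) :
    funX (-1) (-ex (τ / 2)) (ex τ) 1 / funX (-1) (-ex (τ / 2)) (ex τ) (ex (τ / 2)) =
      lambdaInv τ := by
  have hp := norm_ex_lt_one hτ
  have hp0 := ex_ne_zero τ
  obtain ⟨-, -, h13, h22, -, h34⟩ := halfPts_distinct hτ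
  set s := ex (τ / 2) with hs
  have hs0 : s ≠ 0 := ex_ne_zero _
  have hps : ex τ = s ^ 2 := (ex_half_sq τ).symm
  have e1 : theta (-1) (ex τ) = 2 * qPoch (-ex τ) (ex τ) ^ 2 := by
    rw [theta_eq_mul hp, mul_neg_one, div_neg, div_one]
    ring
  have e2 : theta (-s) (ex τ) = qPoch (-s) (ex τ) ^ 2 := by
    rw [theta, sq, div_neg]
    congr 3
    rw [hps]
    field_simp
  have e3 : theta (-1 / s) (ex τ) = theta (-s) (ex τ) / s := by
    have := theta_inv hp (neg_ne_zero.2 hs0)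
    rw [show -1 / s = (-s)⁻¹ by field_simp, this]
    field_simp
  have e4 : theta (-s * s) (ex τ) = theta (-1) (ex τ) := by
    have := theta_mul hp hp0 (x := -1) (by norm_num)
    rw [show -s * s = ex τ * -1 by rw [hps]; ring, this]
    ring
  have hmem : ∀ u ∈ ({1, -1, s, -s} : Finset ℂ), u ∈ halfPts τ := fun u hu => hu
  have n1 : theta (-s) (ex τ) ≠ 0 := by
    have := thetaPM_ne_zero_of_mem_halfPts hτ (hmem (-s) (by simp)) (hmem 1 (by simp)) h13.symm
    rw [thetaPM, mul_one] at this
    exact left_ne_zero_of_mul this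
  have n2 : theta (-1) (ex τ) ≠ 0 := by
    have := thetaPM_ne_zero_of_mem_halfPts hτ (hmem (-s) (by simp)) (hmem s (by simp)) h34.symm
    rw [thetaPM, e4] at this
    exact left_ne_zero_of_mul this
  have hX1 : funX (-1) (-s) (ex τ) 1 = theta (-1) (ex τ) ^ 2 / theta (-s) (ex τ) ^ 2 := by
    rw [funX, thetaPM, thetaPM, mul_one, mul_one, div_one, div_one, sq, sq]
  have hXs : funX (-1) (-s) (ex τ) s = theta (-s) (ex τ) ^ 2 / (s * theta (-1) (ex τ) ^ 2) := by
    rw [funX, thetaPM, thetaPM, e4, e3, neg_one_mul, neg_div, div_self hs0]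
    field_simp
  have h1 : theta (-1) (ex τ) ^ 2 / theta (-s) (ex τ) ^ 2 /
      (theta (-s) (ex τ) ^ 2 / (s * theta (-1) (ex τ) ^ 2)) =
      s * theta (-1) (ex τ) ^ 4 / theta (-s) (ex τ) ^ 4 := by
    field_simp
  rw [hX1, hXs, h1, lambdaInv, e1, e2]
  ring

end EllipticFunctions

end
open EllipticFunctions in
theorem theorem1p7p2 (τ : ℂ) (hτ : 0 < τ.im) :
    -- the elliptic functions `X` and `Y` generate the field, for all admissible `a` and `b`
    (∀ a b : ℂ, a ≠ 0 → b ≠ 0 → (∀ n : ℤ, a * b ≠ ex τ ^ n) → (∀ n : ℤ, a / b ≠ ex τ ^ n) →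
      ∃ X Y : EllipticField τ,
        Represents X (fun z => funX a b (ex τ) (ex z)) ∧
        Represents Y (fun z => funY b (ex τ) (ex z)) ∧
        IntermediateField.adjoin ℂ {X, Y} = ⊤) ∧
    -- for `a`, `b` among `1, -1, √p, -√p`, with `c`, `d` the remaining two numbers, rescaling
    -- `X` and `Y` gives an isomorphism with the field for `l = X(d) / X(c)`
    (∀ a b c d : ℂ, ({a, b, c, d} : Set ℂ) = {1, -1, ex (τ / 2), -ex (τ / 2)} →
      ∃ X Y : EllipticField τ,
        Represents X (fun z => funX a b (ex τ) (ex z)) ∧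
        Represents Y (fun z => funY b (ex τ) (ex z)) ∧
        funX a b (ex τ) c ≠ 0 ∧
        ∃ κ : ℂ, κ ≠ 0 ∧
          ∃ φ : LegendreField (funX a b (ex τ) d / funX a b (ex τ) c) ≃ₐ[ℂ] EllipticField τ,
            φ (legendreX _) = (funX a b (ex τ) c)⁻¹ • X ∧ φ (legendreY _) = κ • Y) ∧
    -- the lambda invariant, which comes from `a = -1` and `b = -√p`
    (∃ X Y : EllipticField τ,
      Represents X (fun z => funX (-1) (-ex (τ / 2)) (ex τ) (ex z)) ∧
      Represents Y (fun z => funY (-ex (τ / 2)) (ex τ) (ex z)) ∧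
      ∃ κ₁ κ₂ : ℂ, κ₁ ≠ 0 ∧ κ₂ ≠ 0 ∧
        ∃ φ : LegendreField (lambdaInv τ) ≃ₐ[ℂ] EllipticField τ,
          φ (legendreX _) = κ₁ • X ∧ φ (legendreY _) = κ₂ • Y) := by
  refine ⟨fun a b ha hb h1 h2 => ⟨ellX hτ ha hb, ellY hτ hb, ⟨funX_ex_mem hτ ha hb, rfl⟩,
    ⟨funY_ex_mem hτ hb, rfl⟩, adjoin_ellX_ellY hτ ha hb h1 h2⟩, fun a b c d h => ?_, ?_⟩
  · have h' := toFinset_eq_halfPts h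
    have ha : a ≠ 0 := ne_zero_of_mem_halfPts (by rw [← h']; simp : a ∈ halfPts τ)
    have hb : b ≠ 0 := ne_zero_of_mem_halfPts (by rw [← h']; simp : b ∈ halfPts τ)
    exact ⟨ellX hτ ha hb, ellY hτ hb, ⟨funX_ex_mem hτ ha hb, rfl⟩, ⟨funY_ex_mem hτ hb, rfl⟩,
      exists_equiv_of_halfPts hτ h' ha hb⟩
  · have hb : -ex (τ / 2) ≠ 0 := neg_ne_zero.2 (ex_ne_zero _)
    have ha : (-1 : ℂ) ≠ 0 := by norm_num
    -- The order `c = √p`, `d = 1` matters: it makes `B / A` equal to `λ(τ)`.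
    have h' : ({-1, -ex (τ / 2), ex (τ / 2), 1} : Multiset ℂ).toFinset = halfPts τ := by
      ext x
      simp [halfPts]
      tauto
    obtain ⟨hA, κ, hκ, hφ⟩ := exists_equiv_of_halfPts hτ h' ha hb
    rw [funX_div_funX_eq_lambdaInv hτ] at hφ
    exact ⟨ellX hτ ha hb, ellY hτ hb, ⟨funX_ex_mem hτ ha hb, rfl⟩, ⟨funY_ex_mem hτ hb, rfl⟩,
      _, κ, inv_ne_zero hA, hκ, hφ⟩
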